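/- Conventions. A vertex ring is an abelian group $V$ with biadditive products $(u,v)\mapsto u_nv$ ($n\in\mathbb Z$) and an element $\mathbf 1$ satisfying regularity ($u_nv=0$ for $n\gg0$), creation ($v_{-1}\mathbf 1=v$ and $v_n\mathbf 1=0$ for $n\ge 0$) and the Jacobi (Borcherds) identity; it is commutative if $u_nv=0$ for all $u,v$ and all $n\ge0$. Put $D_j(v)=v_{-j-1}\mathbf 1$. Let $R$ be a commutative vertex ring; it is a commutative ring under $rs=r_{-1}s$. An $R$-vertex algebra is a vertex ring $V$ with a homomorphism $\iota\colon R\to V$ whose image is central ($\iota(r)_nv=0=v_n\iota(r)$ for all $v \in V$, $n\ge 0$); it is an $R$-module via $rv=\iota(r)_{-1}v$. Homomorphisms preserve all $n$-th products and $\mathbf 1$ and commute with the structure maps $\iota$. It is finitely generated if it has a finite subset contained in no proper $R$-vertex subalgebra. A filtration on $V$ is a chain of $R$-submodules $\cdots\subset F_iV\subset F_{i+1}V\subset\cdots$ $(i\in\mathbb Z)$ with union $V$, with $\mathbf 1\in F_0V$ and $(F_mV)_\ell(F_nV)\subset F_{m+n-\ell-1}V$ for all $m,n,\ell \in \mathbb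 Z$. For a commutative $R$-vertex algebra $S$, the $S$-vertex algebra $V\otimes_RS$ has products $(u\otimes s)_n(v\otimes t)=\sum_{j\ge0}u_{n+j}v\otimes D_j(s)t$, vacuum $\mathbf 1\otimes\mathbf 1$, structure map $s\mapsto\mathbf 1\otimes s$, and is filtered by the images of the $F_iV\otimes_RS$. Let $\mathbf{Aut}(V)$ be the group functor on commutative $R$-vertex algebras sending $S$ to the group of those $S$-vertex algebra automorphisms $f$ of $V\otimes_RS$ for which both $f$ and $f^{-1}$ preserve the filtration (functorial in $S$ by extension of scalars). For a subset $B\subset V$, a $B$-admissible pair $(\nu,b)$ consists of $b\in B$ and a finite, possibly empty, composition $\nu=(b^1)_{k_1}\circ\cdots\circ(b^r)_{k_r}$ of operators $x\mapsto (b^i)_{k_i}x$ with $b^i\in B$, $k_i\in\mathbb Z$ (for $r=0$, $\nu=\mathrm{id}_V$). Theorem. Let $V$ be a filtered $R$-vertex algebra. Assume that there is an integer $n\ge 0$ such that 1. $F_nV$ generates $V$ as an $R$-vertex algebra; 2. $F_nV$ is a free $R$-module with a finite basis $B$; 3. for every $m>n$ there is a set $E_m$ of $B$-admissible pairs such that $F_mV$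 is a free $R$-module with basis $\{\nu(b)\}_{(\nu,b)\in E_m}$; for $m=n$ put $E_n=\{(\mathrm{id}_V,b)\}_{b\in B}$; 4. $E_m\subset E_{m+1}$ for every $m\ge n$; 5. for every $m<n$ the submodule $F_mV$ is a direct summand of the $R$-module $F_nV$. Then $\mathbf{Aut}(V)$ is representable by a finitely generated commutative $R$-vertex algebra, i.e. there are a finitely generated commutative $R$-vertex algebra $A$ and bijections $\mathrm{Hom}_{R}(A,S)\simeq\mathbf{Aut}(V)(S)$, natural in the commutative $R$-vertex algebra $S$. -/

import Mathlib

open scoped TensorProduct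

universe u

/-! ## Vertex rings -/

/-- A vertex ring: an abelian group with biadditive `n`-th products `u_n v = nprod n u v` (`n ∈ ℤ`)
and a vacuum vector, subject to regularity, creation and the Jacobi identity.  The latter is
written in components (the Borcherds identity); its sums are finite by regularity. -/
class VertexRing (V : Type u) extends AddCommGroup V where
  nprod : ℤ → V → V → V
  vac : V
  nprod_add : ∀ (n : ℤ) (u v w : V), nprod n u (v + w) = nprod n u v + nprod n u w
  add_nprod : ∀ (n : ℤ) (u v w : V), nprod n (u + v) w = nprod n u w + nprod n v w
  regularity : ∀ u v : V, ∃ N : ℤ, ∀ n : ℤ, N ≤ n → nprod n u v = 0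
  creation : ∀ v : V, nprod (-1) v vac = v ∧ ∀ n : ℤ, 0 ≤ n → nprod n v vac = 0
  jacobi : ∀ (u v w : V) (l m n : ℤ),
    ∑ᶠ i : ℕ, Ring.choose m i • nprod (m + n - i) (nprod (l + i) u v) w =
    ∑ᶠ i : ℕ, ((-1 : ℤ) ^ i * Ring.choose l i) •
      (nprod (m + l - i) u (nprod (n + i) v w)
        - (Int.negOnePow l : ℤ) • nprod (n + l - i) v (nprod (m + i) u w))

open VertexRing in
/-- Homomorphisms of vertex rings. -/
structure VertexRingHom (V W : Type u) [VertexRing V] [VertexRing W] extends V →+ W where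
  map_nprod' : ∀ (n : ℤ) (x y : V), toFun (nprod n x y) = nprod n (toFun x) (toFun y)
  map_vac' : toFun vac = vac

/-- The centre of a vertex ring. -/
def VertexRing.centre (V : Type u) [VertexRing V] : Set V :=
  {v | ∀ (u : V) (n : ℤ), 0 ≤ n → nprod n v u = 0 ∧ nprod n u v = 0}

/-- A vertex ring is commutative if it equals its centre. -/
class CommVertexRing (R : Type u) extends VertexRing R where
  mem_centre : ∀ r : R, r ∈ VertexRing.centre R

namespace VertexRing

section Basic

variable {V : Type u} [VertexRing V]

/-- The `n`-th product as a biadditive map. -/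
def nprodHom (n : ℤ) : V →+ V →+ V :=
  AddMonoidHom.mk' (fun u => AddMonoidHom.mk' (nprod n u) (nprod_add n u))
    fun u v => by ext w; exact add_nprod n u v w

theorem nprodHom_apply (n : ℤ) (u v : V) : nprodHom n u v = nprod n u v := rfl

@[simp] theorem nprod_zero (n : ℤ) (u : V) : nprod n u 0 = 0 := (nprodHom n u).map_zero

@[simp] theorem zero_nprod (n : ℤ) (u : V) : nprod n 0 u = 0 := by
  rw [← nprodHom_apply, map_zero]; rfl

theorem nprod_sum {ι : Type*} (n : ℤ) (u : V) (s : Finset ι) (f : ι → V) :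
    nprod n u (∑ i ∈ s, f i) = ∑ i ∈ s, nprod n u (f i) := map_sum (nprodHom n u) f s

theorem sum_nprod {ι : Type*} (n : ℤ) (u : V) (s : Finset ι) (f : ι → V) :
    nprod n (∑ i ∈ s, f i) u = ∑ i ∈ s, nprod n (f i) u :=
  map_sum ((nprodHom (V := V) n).flip u) f s

theorem nprod_zsmul (n : ℤ) (u : V) (k : ℤ) (v : V) : nprod n u (k • v) = k • nprod n u v :=
  map_zsmul (nprodHom n u) k v

/-- The canonical Hasse-Schmidt derivation `D_m v = v_{-m-1} 1`. -/
def D (m : ℕ) (v : V) : V := nprod (-(m : ℤ) - 1) v vac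

theorem finsum_eq_range {M : Type*} [AddCommMonoid M] {f : ℕ → M} {N : ℕ}
    (h : ∀ i, N ≤ i → f i = 0) : ∑ᶠ i, f i = ∑ i ∈ Finset.range N, f i := by
  refine finsum_eq_sum_of_support_subset f fun i hi => ?_
  by_contra hc
  exact hi (h i (by simpa using hc))

theorem reg (u v : V) (n : ℤ) : ∃ N : ℕ, ∀ m : ℤ, n + N ≤ m → nprod m u v = 0 := by
  obtain ⟨N, hN⟩ := regularity u v
  exact ⟨(N - n).toNat, fun m hm => hN m (by omega)⟩

theorem nprod_vac_of_nonneg (v : V) {n : ℤ} (h : 0 ≤ n) : nprod n v vac = 0 :=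
  (creation v).2 n h

@[simp] theorem nprod_neg_one_vac (v : V) : nprod (-1) v vac = v := (creation v).1

theorem nprod_comm_of {u v : V} (h : ∀ i : ℤ, 0 ≤ i → nprod i u v = 0) (m n : ℤ) (w : V) :
    nprod m u (nprod n v w) = nprod n v (nprod m u w) := by
  have := jacobi u v w 0 m n
  rw [finsum_eq_range (N := 0) (fun i _ => by rw [h _ (by omega)]; simp),
    finsum_eq_range (N := 1) (fun i hi => by
      obtain ⟨j, rfl⟩ : ∃ j, i = j + 1 := ⟨i - 1, by omega⟩
      simp [Ring.choose_zero_succ])] at this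
  simp at this
  exact (sub_eq_zero.mp this.symm)

theorem nprod_nprod_of {u w : V} (h : ∀ i : ℤ, 0 ≤ i → nprod i u w = 0) (v : V) (l n : ℤ) :
    nprod n (nprod l u v) w =
      ∑ᶠ i : ℕ, ((-1 : ℤ) ^ i * Ring.choose l i) • nprod (l - i) u (nprod (n + i) v w) := by
  have := jacobi u v w l 0 n
  rw [finsum_eq_range (N := 1) (fun i hi => by
      obtain ⟨j, rfl⟩ : ∃ j, i = j + 1 := ⟨i - 1, by omega⟩
      simp [Ring.choose_zero_succ])] at this
  simp at this
  rw [this]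
  refine finsum_congr fun i => ?_
  rw [h _ (by omega)]
  simp

theorem choose_neg_succ (j a : ℕ) :
    (-1 : ℤ) ^ a * Ring.choose (-(j : ℤ) - 1) a = ((j + a).choose a : ℤ) := by
  rw [show (-(j : ℤ) - 1) = -((j : ℤ) + 1) by ring, Ring.choose_neg,
    show (j : ℤ) + 1 + a - 1 = ((j + a : ℕ) : ℤ) by push_cast; ring, Ring.choose_natCast,
    Units.smul_def, smul_eq_mul, ← mul_assoc, Int.coe_negOnePow_natCast, ← mul_pow]
  simp

theorem choose_neg_one (a : ℕ) : (-1 : ℤ) ^ a * Ring.choose (-1 : ℤ) a = 1 := by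
  simpa using choose_neg_succ 0 a

theorem nprod_nprod_neg_one_of {u w : V} (h : ∀ i : ℤ, 0 ≤ i → nprod i u w = 0) (v : V) (n : ℤ) :
    nprod n (nprod (-1) u v) w =
      ∑ᶠ i : ℕ, nprod (-(i : ℤ) - 1) u (nprod (n + i) v w) := by
  rw [nprod_nprod_of h]
  refine finsum_congr fun i => ?_
  rw [choose_neg_one, one_smul]
  congr 1; ring

/-- `Y(1, z)` is the identity. -/
theorem vac_nprod (n : ℤ) (w : V) : nprod n vac w = if n = -1 then w else 0 := by
  have key : ∀ n : ℤ, nprod n vac w = nprod (-1) w (nprod n vac vac) := by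
    intro n
    conv_lhs => rw [← nprod_neg_one_vac w]
    exact (nprod_comm_of (fun i hi => nprod_vac_of_nonneg w hi) _ _ _).symm
  have hvac : ∀ k : ℕ, nprod (-(k : ℤ) - 2) (vac : V) vac = 0 := by
    intro k
    induction k using Nat.strong_induction_on with
    | _ k ih =>
      have h1 := nprod_nprod_neg_one_of (u := (vac : V)) (w := vac)
        (fun i hi => nprod_vac_of_nonneg _ hi) vac (-(k : ℤ) - 2)
      rw [nprod_neg_one_vac, finsum_eq_range (N := k + 2) (fun i hi => by
        rw [nprod_vac_of_nonneg _ (by omega), nprod_zero]), Finset.sum_range_succ,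
        Finset.sum_range_succ', Finset.sum_eq_zero] at h1
      · push_cast at h1
        rw [show -(k : ℤ) - 2 + (k + 1) = -1 by ring, nprod_neg_one_vac,
          show -((k : ℤ) + 1) - 1 = -k - 2 by ring] at h1
        simp only [zero_add, add_zero] at h1
        have key' : nprod (-1) (vac : V) (nprod (-(k : ℤ) - 2) vac vac)
            = nprod (-(k : ℤ) - 2) vac vac := by
          rw [nprod_comm_of (fun i hi => nprod_vac_of_nonneg _ hi), nprod_neg_one_vac]
        norm_num at h1
        rw [key'] at h1
        simpa using h1
      · intro i hi
        have hi := Finset.mem_range.mp hi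
        have : -(k : ℤ) - 2 + ((i + 1 : ℕ) : ℤ) = -((k - (i + 1) : ℕ) : ℤ) - 2 := by omega
        rw [this, ih _ (by omega), nprod_zero]
  rw [key]
  split_ifs with h
  · subst h; simp
  · rcases le_or_gt 0 n with h0 | h0
    · rw [nprod_vac_of_nonneg _ h0, nprod_zero]
    · obtain ⟨k, rfl⟩ : ∃ k : ℕ, n = -(k : ℤ) - 2 := ⟨(-n - 2).toNat, by omega⟩
      rw [hvac, nprod_zero]

@[simp] theorem vac_nprod_neg_one (w : V) : nprod (-1) vac w = w := by simp [vac_nprod]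

theorem vac_mem_centre : (vac : V) ∈ centre V := fun u n hn =>
  ⟨by rw [vac_nprod, if_neg (by omega)], nprod_vac_of_nonneg u hn⟩

theorem D_zero (v : V) : D 0 v = v := by simp [D]

theorem D_vac (m : ℕ) : D m (vac : V) = if m = 0 then vac else 0 := by
  rw [D, vac_nprod]; congr 1; simp

theorem D_D (a j : ℕ) (v : V) : D a (D j v) = ((j + a).choose a : ℤ) • D (j + a) v := by
  have := nprod_nprod_of (u := v) (w := vac) (fun i hi => nprod_vac_of_nonneg _ hi) vac
    (-(j : ℤ) - 1) (-(a : ℤ) - 1)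
  rw [D, D, this, finsum_eq_single _ a, choose_neg_succ]
  · rw [show -(a : ℤ) - 1 + a = -1 by ring, nprod_neg_one_vac, D]
    congr 2; push_cast; ring
  · intro i hi
    rw [vac_nprod, if_neg (by omega), nprod_zero, smul_zero]

/-- `(D_a c)_{-1} w = c_{-a-1} w` -/
theorem D_nprod_of {c w : V} (h : ∀ i : ℤ, 0 ≤ i → nprod i c w = 0) (a : ℕ) :
    nprod (-1) (D a c) w = nprod (-(a : ℤ) - 1) c w := by
  rw [D, nprod_nprod_of h, finsum_eq_single _ 0]
  · simp
  · intro i hi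
    rw [vac_nprod, if_neg (by omega), nprod_zero, smul_zero]

end Basic

theorem sum_triangle {M : Type*} [AddCommMonoid M] (N : ℕ) (f : ℕ → ℕ → M)
    (hf : ∀ a b, N ≤ a + b → f a b = 0) :
    ∑ k ∈ Finset.range N, ∑ p ∈ Finset.HasAntidiagonal.antidiagonal k, f p.1 p.2 =
      ∑ a ∈ Finset.range N, ∑ b ∈ Finset.range N, f a b := by
  rw [← Finset.sum_product', ← Finset.sum_filter_of_ne (p := fun p : ℕ × ℕ => p.1 + p.2 < N),
    Finset.sum_sigma']
  · refine Finset.sum_nbij' (fun x => x.2) (fun p => ⟨p.1 + p.2, p⟩) ?_ ?_ ?_ ?_ ?_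
    · rintro ⟨k, a, b⟩ h
      simp at h ⊢
      omega
    · rintro ⟨a, b⟩ h
      simp at h ⊢
      omega
    · rintro ⟨k, a, b⟩ h
      simp at h ⊢
      omega
    · rintro ⟨a, b⟩ h
      rfl
    · rintro ⟨k, a, b⟩ h
      rfl
  · intro p _ hp
    by_contra hc
    exact hp (hf _ _ (by omega))

theorem sum_shift {M : Type*} [AddCommMonoid M] (N j : ℕ) (g : ℕ → M)
    (h0 : ∀ p, p < j → g p = 0) (h1 : ∀ p, N ≤ p → g p = 0) :
    ∑ a ∈ Finset.range N, g (j + a) = ∑ p ∈ Finset.range N, g p := by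
  have h2 : ∑ p ∈ Finset.range (j + N), g p = ∑ p ∈ Finset.range N, g p := by
    rw [add_comm, Finset.sum_range_add, Finset.sum_eq_zero (fun i _ => h1 (N + i) (by omega)),
      add_zero]
  rw [← h2, Finset.sum_range_add, Finset.sum_eq_zero (fun i hi => h0 i (by simpa using hi)),
    zero_add]

end VertexRing

/-! ## Commutative vertex rings as commutative rings, vertex algebras and their modules -/

namespace CommVertexRing

open VertexRing

variable {R : Type u} [CommVertexRing R]

theorem nprod_nonneg (r s : R) {n : ℤ} (hn : 0 ≤ n) : nprod n r s = 0 :=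
  (mem_centre r s n hn).1

/-- A commutative vertex ring is a commutative ring with product `r s = r_{-1} s` and unit the
vacuum vector. -/
instance toCommRing : CommRing R :=
  { (inferInstance : AddCommGroup R) with
    mul := fun r s => nprod (-1) r s
    one := vac
    left_distrib := fun a b c => nprod_add (-1) a b c
    right_distrib := fun a b c => add_nprod (-1) a b c
    zero_mul := fun a => zero_nprod (-1) a
    mul_zero := fun a => nprod_zero (-1) a
    one_mul := fun a => vac_nprod_neg_one a
    mul_one := fun a => nprod_neg_one_vac a
    mul_comm := fun a b => by
      change nprod (-1) a b = nprod (-1) b a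
      have := nprod_comm_of (u := a) (v := b) (fun i hi => nprod_nonneg _ _ hi) (-1) (-1) vac
      simpa using this
    mul_assoc := fun a b c => by
      have := nprod_nprod_neg_one_of (u := a) (w := c) (fun i hi => nprod_nonneg _ _ hi) b (-1)
      refine this.trans ?_
      rw [finsum_eq_single _ 0]
      · simp; rfl
      · intro i hi
        have h0 : nprod (-1 + (i : ℤ)) b c = 0 := nprod_nonneg _ _ (by omega)
        rw [h0, nprod_zero] }

theorem mul_def (r s : R) : r * s = nprod (-1) r s := rfl

theorem one_def : (1 : R) = vac := rfl

theorem D_mul_eq (a : ℕ) (r s : R) : D a r * s = nprod (-(a : ℤ) - 1) r s :=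
  D_nprod_of (fun _ hi => nprod_nonneg _ _ hi) a

theorem D_mul (k : ℕ) (c d : R) :
    D k (c * d) = ∑ p ∈ Finset.HasAntidiagonal.antidiagonal k, D p.1 c * D p.2 d := by
  rw [mul_def, D, nprod_nprod_neg_one_of (fun i hi => nprod_nonneg _ _ hi),
    finsum_eq_range (N := k + 1) (fun _ hi => by
      rw [nprod_vac_of_nonneg _ (by omega), nprod_zero]),
    Finset.Nat.sum_antidiagonal_eq_sum_range_succ_mk]
  refine Finset.sum_congr rfl fun i hi => ?_
  have hi := Finset.mem_range.mp hi
  rw [D_mul_eq, D]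
  congr 2
  omega

end CommVertexRing

/-- A vertex algebra over a commutative vertex ring `R`: a vertex ring `V` with a homomorphism
`R → V` whose image lies in the centre of `V`. -/
class VertexAlgebra (R V : Type u) [CommVertexRing R] [VertexRing V] where
  ι : VertexRingHom R V
  ι_mem_centre : ∀ r : R, ι.toFun r ∈ VertexRing.centre V

namespace VertexAlgebra

open VertexRing CommVertexRing

section

variable (R : Type u) {V : Type u} [CommVertexRing R] [VertexRing V] [VertexAlgebra R V]

variable (V) in
/-- The structure map of an `R`-vertex algebra. -/
def str (r : R) : V := (ι (R := R) (V := V)).toFun r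

variable {R}

theorem str_mem (r : R) : str R V r ∈ centre V := ι_mem_centre r

theorem str_nprod_nonneg (r : R) (v : V) {n : ℤ} (h : 0 ≤ n) : nprod n (str R V r) v = 0 :=
  (str_mem r v n h).1

theorem nprod_str_nonneg (r : R) (v : V) {n : ℤ} (h : 0 ≤ n) : nprod n v (str R V r) = 0 :=
  (str_mem r v n h).2

theorem str_nprod (n : ℤ) (r s : R) : str R V (nprod n r s) = nprod n (str R V r) (str R V s) :=
  ι.map_nprod' n r s

theorem str_add (r s : R) : str R V (r + s) = str R V r + str R V s :=
  ι.map_add' r s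

theorem str_zero : str R V (0 : R) = 0 := ι.map_zero'

theorem str_vac : str R V (vac : R) = vac := ι.map_vac'

theorem str_D (a : ℕ) (r : R) : str R V (D a r) = D a (str R V r) := by
  rw [D, str_nprod, str_vac, D]

/-- An `R`-vertex algebra is an `R`-module via `r v = ι(r)_{-1} v`. -/
instance toModule : Module R V where
  smul r v := nprod (-1) (str R V r) v
  one_smul v := by
    change nprod (-1) (str R V vac) v = v
    rw [str_vac, vac_nprod_neg_one]
  mul_smul r s v := by
    change nprod (-1) (str R V (nprod (-1) r s)) v = _
    rw [str_nprod, nprod_nprod_neg_one_of (fun i hi => str_nprod_nonneg _ _ hi),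
      finsum_eq_single _ 0]
    · simp; rfl
    · intro i hi
      have h0 : nprod (-1 + (i : ℤ)) (str R V s) v = 0 := str_nprod_nonneg _ _ (by omega)
      rw [h0, nprod_zero]
  smul_zero r := nprod_zero _ _
  smul_add r v w := nprod_add _ _ _ _
  add_smul r s v := by
    change nprod (-1) (str R V (r + s)) v = _
    rw [str_add, add_nprod]; rfl
  zero_smul v := by
    change nprod (-1) (str R V 0) v = _
    rw [str_zero, zero_nprod]

theorem smul_def (r : R) (v : V) : r • v = nprod (-1) (str R V r) v := rfl

theorem D_smul_eq (a : ℕ) (r : R) (v : V) :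
    D a r • v = nprod (-(a : ℤ) - 1) (str R V r) v := by
  rw [smul_def, str_D, D_nprod_of (fun i hi => str_nprod_nonneg _ _ hi)]

theorem smul_vac (r : R) : r • (vac : V) = str R V r := by
  rw [smul_def, nprod_neg_one_vac]

theorem smul_nprod (n : ℤ) (r : R) (u v : V) :
    nprod n (r • u) v = ∑ᶠ i : ℕ, D i r • nprod (n + i) u v := by
  rw [smul_def, nprod_nprod_neg_one_of (fun i hi => str_nprod_nonneg _ _ hi)]
  exact finsum_congr fun i => (D_smul_eq i r _).symm

theorem nprod_smul (n : ℤ) (r : R) (u v : V) : nprod n u (r • v) = r • nprod n u v := by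
  rw [smul_def, smul_def, nprod_comm_of (fun i hi => nprod_str_nonneg _ _ hi)]

end
end VertexAlgebra

/-! ## Base change -/

/-- The `S`-vertex algebra `V ⊗_R S` obtained from the `R`-vertex algebra `V` by base change to a
commutative `R`-vertex algebra `S`. -/
def BaseChange (R V S : Type u) [CommVertexRing R] [VertexRing V] [VertexAlgebra R V]
    [CommVertexRing S] [VertexAlgebra R S] : Type u := V ⊗[R] S

namespace BaseChange

open VertexRing CommVertexRing VertexAlgebra

section

variable {R V S : Type u} [CommVertexRing R] [VertexRing V] [VertexAlgebra R V]
  [CommVertexRing S] [VertexAlgebra R S]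

noncomputable instance : AddCommGroup (BaseChange R V S) :=
  inferInstanceAs (AddCommGroup (V ⊗[R] S))

variable (R) in
/-- Pure tensors. -/
def tmul (v : V) (s : S) : BaseChange R V S := v ⊗ₜ[R] s

theorem add_tmul (v w : V) (s : S) : tmul R (v + w) s = tmul R v s + tmul R w s :=
  TensorProduct.add_tmul v w s

theorem tmul_add (v : V) (s t : S) : tmul R v (s + t) = tmul R v s + tmul R v t :=
  TensorProduct.tmul_add v s t

theorem smul_tmul (r : R) (v : V) (s : S) : tmul R (r • v) s = tmul R v (str R S r * s) :=
  TensorProduct.smul_tmul r v s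

@[simp] theorem zero_tmul (s : S) : tmul R (0 : V) s = 0 := TensorProduct.zero_tmul V s

@[simp] theorem tmul_zero (v : V) : tmul R v (0 : S) = 0 := TensorProduct.tmul_zero S v

theorem sum_tmul {κ : Type*} (F : Finset κ) (f : κ → V) (s : S) :
    tmul R (∑ i ∈ F, f i) s = ∑ i ∈ F, tmul R (f i) s := TensorProduct.sum_tmul F f s

theorem tmul_sum {κ : Type*} (F : Finset κ) (v : V) (f : κ → S) :
    tmul R v (∑ i ∈ F, f i) = ∑ i ∈ F, tmul R v (f i) := TensorProduct.tmul_sum v F f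

theorem zsmul_tmul (k : ℤ) (v : V) (s : S) : tmul R (k • v) s = k • tmul R v s :=
  map_zsmul (AddMonoidHom.mk' (fun v : V => tmul R v s) fun _ _ => add_tmul _ _ _) k v

theorem sub_tmul (v w : V) (s : S) : tmul R (v - w) s = tmul R v s - tmul R w s :=
  map_sub (AddMonoidHom.mk' (fun v : V => tmul R v s) fun _ _ => add_tmul _ _ _) v w

theorem tmul_zsmul (k : ℤ) (v : V) (s : S) : tmul R v (k • s) = k • tmul R v s :=
  map_zsmul (AddMonoidHom.mk' (fun s : S => tmul R v s) fun _ _ => tmul_add _ _ _) k s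

@[elab_as_elim]
theorem induction_on {P : BaseChange R V S → Prop} (x : BaseChange R V S) (zero : P 0)
    (tmul : ∀ v s, P (tmul R v s)) (add : ∀ x y, P x → P y → P (x + y)) : P x :=
  TensorProduct.induction_on (motive := P) x zero tmul add

/-- `(u ⊗ s)_n (v ⊗ t) = ∑_j u_{n+j} v ⊗ D_j(s) t` -/
noncomputable def pureProd (n : ℤ) (u : V) (s : S) (v : V) (t : S) : BaseChange R V S :=
  ∑ᶠ j : ℕ, tmul R (nprod (n + j) u v) (D j s * t)

theorem pureProd_eq {n : ℤ} {u v : V} {N : ℕ} (h : ∀ j : ℕ, N ≤ j → nprod (n + j) u v = 0)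
    (s t : S) : pureProd (R := R) n u s v t =
      ∑ j ∈ Finset.range N, tmul R (nprod (n + j) u v) (D j s * t) :=
  finsum_eq_range fun j hj => by rw [h j hj, zero_tmul]

theorem D_add (a : ℕ) (s t : S) : D a (s + t) = D a s + D a t := add_nprod _ _ _ _

theorem D_zero' (a : ℕ) : D a (0 : S) = 0 := zero_nprod _ _

theorem reg' (u v : V) (n : ℤ) : ∃ N : ℕ, ∀ M : ℕ, N ≤ M → ∀ j : ℕ, M ≤ j →
    nprod (n + j) u v = 0 := by
  obtain ⟨N, hN⟩ := reg u v n
  exact ⟨N, fun M hM j hj => hN _ (by omega)⟩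

/-- Expansion of the Leibniz rule inside a sum. -/
theorem sum_D_mul (N : ℕ) (y : ℕ → V) (hy : ∀ k, N ≤ k → y k = 0) (c d t : S) :
    ∑ k ∈ Finset.range N, tmul R (y k) (D k (c * d) * t) =
      ∑ a ∈ Finset.range N, ∑ b ∈ Finset.range N, tmul R (y (a + b)) (D a c * D b d * t) := by
  rw [← sum_triangle N (fun a b => tmul R (y (a + b)) (D a c * D b d * t))
    (fun a b h => by rw [hy _ h, zero_tmul])]
  refine Finset.sum_congr rfl fun k _ => ?_
  rw [D_mul, Finset.sum_mul, tmul_sum]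
  refine Finset.sum_congr rfl fun p hp => ?_
  rw [Finset.HasAntidiagonal.mem_antidiagonal.mp hp]

theorem pureProd_smul_left (n : ℤ) (r : R) (u : V) (s : S) (v : V) (t : S) :
    pureProd (R := R) n (r • u) s v t = pureProd n u (r • s) v t := by
  obtain ⟨N₁, h₁⟩ := reg' u v n
  obtain ⟨N₂, h₂⟩ := reg' (r • u) v n
  set N := max N₁ N₂
  have h₁ := h₁ N (le_max_left _ _)
  have h₂ := h₂ N (le_max_right _ _)
  have hrs : r • s = str R S r * s := rfl
  rw [pureProd_eq h₁, pureProd_eq h₂, hrs,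
    sum_D_mul N (fun k => nprod (n + k) u v) h₁, Finset.sum_comm]
  refine Finset.sum_congr rfl fun j _ => ?_
  rw [smul_nprod, finsum_eq_range (N := N) (fun i hi => by
    rw [add_assoc, ← Nat.cast_add, h₁ _ (by omega), smul_zero]), sum_tmul]
  refine Finset.sum_congr rfl fun i _ => ?_
  rw [smul_tmul, str_D, mul_assoc]
  congr 2
  push_cast; ring

theorem pureProd_smul_right (n : ℤ) (r : R) (u : V) (s : S) (v : V) (t : S) :
    pureProd (R := R) n u s (r • v) t = pureProd n u s v (r • t) := by
  refine finsum_congr fun j => ?_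
  rw [nprod_smul, smul_tmul, VertexAlgebra.smul_def, ← mul_def]
  congr 1; ring

theorem pureProd_add_left (n : ℤ) (u u' : V) (s : S) (v : V) (t : S) :
    pureProd (R := R) n (u + u') s v t = pureProd n u s v t + pureProd n u' s v t := by
  obtain ⟨N₁, h₁⟩ := reg' u v n
  obtain ⟨N₂, h₂⟩ := reg' u' v n
  have h₁ := h₁ (max N₁ N₂) (le_max_left _ _)
  have h₂ := h₂ (max N₁ N₂) (le_max_right _ _)
  rw [pureProd_eq h₁, pureProd_eq h₂, pureProd_eq (N := max N₁ N₂) (fun j hj => by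
    rw [add_nprod, h₁ j hj, h₂ j hj, add_zero]), ← Finset.sum_add_distrib]
  simp only [add_nprod, add_tmul]

theorem pureProd_add_right (n : ℤ) (u v v' : V) (s : S) (t : S) :
    pureProd (R := R) n u s (v + v') t = pureProd n u s v t + pureProd n u s v' t := by
  obtain ⟨N₁, h₁⟩ := reg' u v n
  obtain ⟨N₂, h₂⟩ := reg' u v' n
  have h₁ := h₁ (max N₁ N₂) (le_max_left _ _)
  have h₂ := h₂ (max N₁ N₂) (le_max_right _ _)
  rw [pureProd_eq h₁, pureProd_eq h₂, pureProd_eq (N := max N₁ N₂) (fun j hj => by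
    rw [nprod_add, h₁ j hj, h₂ j hj, add_zero]), ← Finset.sum_add_distrib]
  simp only [nprod_add, add_tmul]

theorem pureProd_add_left' (n : ℤ) (u v : V) (s s' t : S) :
    pureProd (R := R) n u (s + s') v t = pureProd n u s v t + pureProd n u s' v t := by
  obtain ⟨N, h⟩ := reg' u v n
  have h := h N le_rfl
  simp only [pureProd_eq h, ← Finset.sum_add_distrib, D_add, add_mul, tmul_add]

theorem pureProd_add_right' (n : ℤ) (u v : V) (s t t' : S) :
    pureProd (R := R) n u s v (t + t') = pureProd n u s v t + pureProd n u s v t' := by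
  obtain ⟨N, h⟩ := reg' u v n
  have h := h N le_rfl
  simp only [pureProd_eq h, ← Finset.sum_add_distrib, mul_add, tmul_add]

/-- The product `(u ⊗ s)_n x` as an additive map in `x`. -/
noncomputable def prodRight (n : ℤ) (u : V) (s : S) : BaseChange R V S →+ BaseChange R V S :=
  TensorProduct.liftAddHom (R := R) (M := V) (N := S) (P := BaseChange R V S)
    (AddMonoidHom.mk' (fun v => AddMonoidHom.mk' (fun t => pureProd n u s v t)
      (pureProd_add_right' n u v s))
      fun v v' => by ext t; exact pureProd_add_right n u v v' s t)
    (fun r v t => pureProd_smul_right n r u s v t)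

theorem hom_ext {M : Type*} [AddCommMonoid M] {f g : BaseChange R V S →+ M}
    (h : ∀ v s, f (tmul R v s) = g (tmul R v s)) : f = g := by
  refine AddMonoidHom.ext fun x => ?_
  induction x using induction_on with
  | zero => rw [map_zero, map_zero]
  | tmul v t => exact h v t
  | add x y hx hy => rw [map_add, map_add, hx, hy]

/-- The `n`-th product on `V ⊗_R S`. -/
noncomputable def prodHom (n : ℤ) : BaseChange R V S →+ BaseChange R V S →+ BaseChange R V S :=
  TensorProduct.liftAddHom (R := R) (M := V) (N := S) (P := BaseChange R V S →+ BaseChange R V S)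
    (AddMonoidHom.mk' (fun u => AddMonoidHom.mk' (fun s => prodRight n u s)
      (fun s s' => hom_ext fun v t => pureProd_add_left' n u v s s' t))
      fun u u' => AddMonoidHom.ext fun s => hom_ext fun v t => pureProd_add_left n u u' s v t)
    (fun r u s => hom_ext fun v t => pureProd_smul_left n r u s v t)

theorem prodHom_tmul (n : ℤ) (u : V) (s : S) (v : V) (t : S) :
    prodHom n (tmul R u s) (tmul R v t) = pureProd n u s v t := rfl

theorem prodHom_regular (x y : BaseChange R V S) :
    ∃ N : ℤ, ∀ n : ℤ, N ≤ n → prodHom n x y = 0 := by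
  induction x using induction_on with
  | zero => exact ⟨0, fun n _ => by simp⟩
  | add x x' hx hx' =>
    obtain ⟨N, hN⟩ := hx
    obtain ⟨N', hN'⟩ := hx'
    exact ⟨max N N', fun n hn => by
      rw [map_add, AddMonoidHom.add_apply, hN n (by omega), hN' n (by omega), add_zero]⟩
  | tmul u s =>
    induction y using induction_on with
    | zero => exact ⟨0, fun n _ => by simp⟩
    | add x x' hx hx' =>
      obtain ⟨N, hN⟩ := hx
      obtain ⟨N', hN'⟩ := hx'
      exact ⟨max N N', fun n hn => by
        rw [map_add, hN n (by omega), hN' n (by omega), add_zero]⟩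
    | tmul v t =>
      obtain ⟨N, hN⟩ := regularity u v
      refine ⟨N, fun n hn => ?_⟩
      rw [prodHom_tmul, pureProd_eq (N := 0) (fun j _ => hN _ (by omega))]
      simp

theorem exists_bound (P : ℕ → ℤ → Prop) (base : ℤ) (N₁ : ℕ) (h₁ : ∀ q, N₁ ≤ q → ∀ r, P q r)
    (h₂ : ∀ q, ∃ M : ℕ, ∀ r : ℤ, base + M ≤ r → P q r) :
    ∃ N₀ : ℕ, ∀ N, N₀ ≤ N → ∀ (q : ℕ) (r : ℤ), base + N ≤ r + q → P q r := by
  choose M hM using h₂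
  refine ⟨N₁ + (Finset.range N₁).sup M, fun N hN q r h => ?_⟩
  rcases le_or_gt N₁ q with hq | hq
  · exact h₁ q hq r
  · have : M q ≤ (Finset.range N₁).sup M := Finset.le_sup (by simpa using hq)
    exact hM q r (by omega)

theorem bound_left (u v w : V) (l base : ℤ) : ∃ N₀ : ℕ, ∀ N, N₀ ≤ N → ∀ (q : ℕ) (r : ℤ),
    base + N ≤ r + q → nprod r (nprod (l + q) u v) w = 0 := by
  obtain ⟨N₁, h₁⟩ := reg u v l
  refine exists_bound _ base N₁ (fun q hq r => ?_) (fun q => ?_)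
  · rw [h₁ _ (by omega), zero_nprod]
  · exact reg _ w base

theorem bound_right (u v w : V) (n base : ℤ) : ∃ N₀ : ℕ, ∀ N, N₀ ≤ N → ∀ (q : ℕ) (r : ℤ),
    base + N ≤ r + q → nprod r u (nprod (n + q) v w) = 0 := by
  obtain ⟨N₁, h₁⟩ := reg v w n
  refine exists_bound _ base N₁ (fun q hq r => ?_) (fun q => ?_)
  · rw [h₁ _ (by omega), nprod_zero]
  · exact reg u _ base

/-- The Borcherds identity with all sums truncated at `N`. -/
theorem jacobi_pure (u v w : V) (s t x : S) (l m n : ℤ) : ∃ N₀ : ℕ, ∀ N, N₀ ≤ N →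
    ∑ i ∈ Finset.range N, Ring.choose m i • prodHom (m + n - i)
      (prodHom (l + i) (tmul R u s) (tmul R v t)) (tmul R w x) =
    ∑ i ∈ Finset.range N, ((-1 : ℤ) ^ i * Ring.choose l i) •
      (prodHom (m + l - i) (tmul R u s) (prodHom (n + i) (tmul R v t) (tmul R w x))
        - (Int.negOnePow l : ℤ) •
          prodHom (n + l - i) (tmul R v t) (prodHom (m + i) (tmul R u s) (tmul R w x))) := by
  obtain ⟨A₁, a₁⟩ := reg' u v l
  obtain ⟨A₂, a₂⟩ := reg' v w n
  obtain ⟨A₃, a₃⟩ := reg' u w m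
  obtain ⟨B₁, b₁⟩ := bound_left u v w l (m + n)
  obtain ⟨B₂, b₂⟩ := bound_right u v w n (m + l)
  obtain ⟨B₃, b₃⟩ := bound_right v u w m (n + l)
  refine ⟨A₁ + A₂ + A₃ + B₁ + B₂ + B₃, fun N hN => ?_⟩
  replace a₁ := a₁ N (by omega)
  replace a₂ := a₂ N (by omega)
  replace a₃ := a₃ N (by omega)
  replace b₁ := b₁ N (by omega)
  replace b₂ := b₂ N (by omega)
  replace b₃ := b₃ N (by omega)
  -- the three kinds of iterated products
  have e₁ : ∀ i : ℕ, prodHom (m + n - i) (prodHom (l + i) (tmul R u s) (tmul R v t))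
      (tmul R w x) = ∑ j ∈ Finset.range N, ∑ p ∈ Finset.range N, ∑ b ∈ Finset.range N,
        (p.choose j : ℤ) • tmul R
          (nprod ((m + p) + (n + b) - (i + j : ℕ)) (nprod (l + (i + j : ℕ)) u v) w)
          (D p s * (D b t * x)) := by
    intro i
    rw [prodHom_tmul, pureProd_eq (N := N) (fun j hj => by
      rw [add_assoc, ← Nat.cast_add]; exact a₁ _ (by omega)), map_sum,
      AddMonoidHom.finsetSum_apply]
    refine Finset.sum_congr rfl fun j _ => ?_
    have hz : ∀ k : ℕ, N ≤ k → nprod (m + n - i + k) (nprod (l + i + j) u v) w = 0 := by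
      intro k hk
      have := b₁ (i + j) (m + n - i + k) (by push_cast; omega)
      rwa [Nat.cast_add, ← add_assoc] at this
    rw [prodHom_tmul, pureProd_eq hz,
      sum_D_mul N (fun k => nprod (m + n - i + k) (nprod (l + i + j) u v) w) hz,
      ← sum_shift N j (fun p => ∑ b ∈ Finset.range N, (p.choose j : ℤ) • tmul R
          (nprod ((m + p) + (n + b) - (i + j : ℕ)) (nprod (l + (i + j : ℕ)) u v) w)
          (D p s * (D b t * x)))]
    · refine Finset.sum_congr rfl fun a _ => Finset.sum_congr rfl fun b _ => ?_
      rw [D_D, Nat.choose_symm_add, smul_mul_assoc, smul_mul_assoc, tmul_zsmul, mul_assoc]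
      congr 3
      · push_cast; ring
      · congr 1; push_cast; ring
    · intro p hp
      refine Finset.sum_eq_zero fun b _ => ?_
      rw [Nat.choose_eq_zero_of_lt hp, Nat.cast_zero, zero_smul]
    · intro p hp
      refine Finset.sum_eq_zero fun b _ => ?_
      rw [b₁ (i + j) _ (by push_cast; omega), zero_tmul, smul_zero]
  have e₂ : ∀ i : ℕ, prodHom (m + l - i) (tmul R u s) (prodHom (n + i) (tmul R v t)
      (tmul R w x)) = ∑ p ∈ Finset.range N, ∑ b ∈ Finset.range N,
        tmul R (nprod ((m + p) + l - i) u (nprod ((n + b) + i) v w)) (D p s * (D b t * x)) := by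
    intro i
    rw [prodHom_tmul, pureProd_eq (N := N) (fun j hj => by
      rw [add_assoc, ← Nat.cast_add]; exact a₂ _ (by omega)), map_sum, Finset.sum_comm]
    refine Finset.sum_congr rfl fun b _ => ?_
    rw [prodHom_tmul, pureProd_eq (N := N)]
    · refine Finset.sum_congr rfl fun p _ => ?_
      congr 2
      · ring
      · congr 1; ring
    · intro p hp
      have := b₂ (i + b) (m + l - i + p) (by push_cast; omega)
      rwa [Nat.cast_add, ← add_assoc] at this
  have e₃ : ∀ i : ℕ, prodHom (n + l - i) (tmul R v t) (prodHom (m + i) (tmul R u s)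
      (tmul R w x)) = ∑ p ∈ Finset.range N, ∑ b ∈ Finset.range N,
        tmul R (nprod ((n + b) + l - i) v (nprod ((m + p) + i) u w)) (D p s * (D b t * x)) := by
    intro i
    rw [prodHom_tmul, pureProd_eq (N := N) (fun j hj => by
      rw [add_assoc, ← Nat.cast_add]; exact a₃ _ (by omega)), map_sum]
    refine Finset.sum_congr rfl fun p _ => ?_
    rw [prodHom_tmul, pureProd_eq (N := N)]
    · refine Finset.sum_congr rfl fun b _ => ?_
      congr 1
      · congr 1
        · ring
        · congr 1; ring
      · ring
    · intro b hb
      have := b₃ (i + p) (n + l - i + b) (by push_cast; omega)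
      rwa [Nat.cast_add, ← add_assoc] at this
  simp only [e₁, e₂, e₃]
  -- the identity for `V`, with truncated sums
  have J : ∀ p b : ℕ, ∑ q ∈ Finset.range N, Ring.choose (m + p) q •
      nprod ((m + p) + (n + b) - q) (nprod (l + q) u v) w =
      ∑ i ∈ Finset.range N, ((-1 : ℤ) ^ i * Ring.choose l i) •
        (nprod ((m + p) + l - i) u (nprod ((n + b) + i) v w)
        - (Int.negOnePow l : ℤ) • nprod ((n + b) + l - i) v (nprod ((m + p) + i) u w)) := by
    intro p b
    have := jacobi u v w l (m + p) (n + b)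
    rwa [finsum_eq_range (N := N) (fun i hi => by rw [a₁ i hi, zero_nprod, smul_zero]),
      finsum_eq_range (N := N) (fun i hi => by
        have z₂ : nprod (n + b + i) v w = 0 := by
          rw [add_assoc, ← Nat.cast_add]; exact a₂ _ (by omega)
        have z₃ : nprod (m + p + i) u w = 0 := by
          rw [add_assoc, ← Nat.cast_add]; exact a₃ _ (by omega)
        rw [z₂, z₃, nprod_zero, nprod_zero, smul_zero, sub_zero, smul_zero])] at this
  trans ∑ p ∈ Finset.range N, ∑ b ∈ Finset.range N, tmul R
    (∑ q ∈ Finset.range N, Ring.choose (m + p) q •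
      nprod ((m + p) + (n + b) - q) (nprod (l + q) u v) w) (D p s * (D b t * x))
  · simp only [Finset.smul_sum]
    have hswap : ∀ f : ℕ → ℕ → ℕ → ℕ → BaseChange R V S,
        ∑ i ∈ Finset.range N, ∑ j ∈ Finset.range N, ∑ p ∈ Finset.range N, ∑ b ∈ Finset.range N,
          f i j p b = ∑ p ∈ Finset.range N, ∑ b ∈ Finset.range N, ∑ i ∈ Finset.range N,
            ∑ j ∈ Finset.range N, f i j p b := by
      intro f
      calc _ = ∑ i ∈ Finset.range N, ∑ p ∈ Finset.range N, ∑ j ∈ Finset.range N,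
              ∑ b ∈ Finset.range N, f i j p b :=
            Finset.sum_congr rfl fun i _ => Finset.sum_comm
        _ = ∑ i ∈ Finset.range N, ∑ p ∈ Finset.range N, ∑ b ∈ Finset.range N,
              ∑ j ∈ Finset.range N, f i j p b :=
            Finset.sum_congr rfl fun i _ => Finset.sum_congr rfl fun p _ => Finset.sum_comm
        _ = ∑ p ∈ Finset.range N, ∑ i ∈ Finset.range N, ∑ b ∈ Finset.range N,
              ∑ j ∈ Finset.range N, f i j p b := Finset.sum_comm
        _ = _ := Finset.sum_congr rfl fun p _ => Finset.sum_comm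
    rw [hswap]
    refine Finset.sum_congr rfl fun p _ => Finset.sum_congr rfl fun b _ => ?_
    rw [sum_tmul, ← sum_triangle N (fun i j => Ring.choose m i • (p.choose j : ℤ) • tmul R
          (nprod ((m + p) + (n + b) - (i + j : ℕ)) (nprod (l + (i + j : ℕ)) u v) w)
          (D p s * (D b t * x))) (fun i j h => by
            rw [a₁ _ h, zero_nprod, zero_tmul, smul_zero, smul_zero])]
    refine Finset.sum_congr rfl fun q _ => ?_
    rw [zsmul_tmul, Ring.add_choose_eq q (Commute.all m (p : ℤ)), Finset.sum_smul]
    refine Finset.sum_congr rfl fun ij hij => ?_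
    rw [Finset.HasAntidiagonal.mem_antidiagonal.mp hij, mul_smul, Ring.choose_natCast]
  · simp only [J, sum_tmul]
    have hswap : ∀ f : ℕ → ℕ → ℕ → BaseChange R V S,
        ∑ p ∈ Finset.range N, ∑ b ∈ Finset.range N, ∑ i ∈ Finset.range N, f p b i
          = ∑ i ∈ Finset.range N, ∑ p ∈ Finset.range N, ∑ b ∈ Finset.range N, f p b i := by
      intro f
      calc _ = ∑ p ∈ Finset.range N, ∑ i ∈ Finset.range N, ∑ b ∈ Finset.range N, f p b i :=
            Finset.sum_congr rfl fun p _ => Finset.sum_comm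
        _ = _ := Finset.sum_comm
    rw [hswap]
    refine Finset.sum_congr rfl fun i _ => ?_
    rw [Finset.smul_sum, ← Finset.sum_sub_distrib, Finset.smul_sum]
    refine Finset.sum_congr rfl fun p _ => ?_
    rw [Finset.smul_sum, ← Finset.sum_sub_distrib, Finset.smul_sum]
    refine Finset.sum_congr rfl fun b _ => ?_
    rw [zsmul_tmul, sub_tmul, zsmul_tmul]

theorem jacobi_truncated (x y z : BaseChange R V S) (l m n : ℤ) : ∃ N₀ : ℕ, ∀ N, N₀ ≤ N →
    ∑ i ∈ Finset.range N, Ring.choose m i • prodHom (m + n - i) (prodHom (l + i) x y) z =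
    ∑ i ∈ Finset.range N, ((-1 : ℤ) ^ i * Ring.choose l i) •
      (prodHom (m + l - i) x (prodHom (n + i) y z)
        - (Int.negOnePow l : ℤ) • prodHom (n + l - i) y (prodHom (m + i) x z)) := by
  have hadd : ∀ a b c d : BaseChange R V S, a + b - (c + d) = (a - c) + (b - d) :=
    fun a b c d => by abel
  induction x using induction_on with
  | zero => exact ⟨0, fun N _ => by simp⟩
  | add x x' hx hx' =>
    obtain ⟨N, hN⟩ := hx
    obtain ⟨N', hN'⟩ := hx'
    refine ⟨N + N', fun M hM => ?_⟩
    simp only [map_add, AddMonoidHom.add_apply, smul_add, hadd, Finset.sum_add_distrib,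
      hN M (by omega), hN' M (by omega)]
  | tmul u s =>
    induction y using induction_on with
    | zero => exact ⟨0, fun N _ => by simp⟩
    | add x x' hx hx' =>
      obtain ⟨N, hN⟩ := hx
      obtain ⟨N', hN'⟩ := hx'
      refine ⟨N + N', fun M hM => ?_⟩
      simp only [map_add, AddMonoidHom.add_apply, smul_add, hadd, Finset.sum_add_distrib,
        hN M (by omega), hN' M (by omega)]
    | tmul v t =>
      induction z using induction_on with
      | zero => exact ⟨0, fun N _ => by simp⟩
      | add x x' hx hx' =>
        obtain ⟨N, hN⟩ := hx
        obtain ⟨N', hN'⟩ := hx'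
        refine ⟨N + N', fun M hM => ?_⟩
        simp only [map_add, smul_add, hadd, Finset.sum_add_distrib,
          hN M (by omega), hN' M (by omega)]
      | tmul w r => exact jacobi_pure u v w s t r l m n

theorem creation_aux (n : ℤ) (x : BaseChange R V S) :
    (n = -1 → prodHom n x (tmul R vac vac) = x) ∧
      (0 ≤ n → prodHom n x (tmul R vac vac) = 0) := by
  induction x using induction_on with
  | zero => simp
  | add x y hx hy =>
    refine ⟨fun h => ?_, fun h => ?_⟩
    · rw [map_add, AddMonoidHom.add_apply, hx.1 h, hy.1 h]
    · rw [map_add, AddMonoidHom.add_apply, hx.2 h, hy.2 h, add_zero]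
  | tmul v s =>
    refine ⟨fun h => ?_, fun h => ?_⟩
    · subst h
      rw [prodHom_tmul, pureProd_eq (N := 1) (fun j hj => nprod_vac_of_nonneg _ (by omega))]
      simp [D_zero, ← one_def]
    · rw [prodHom_tmul, pureProd_eq (N := 0) (fun j hj => nprod_vac_of_nonneg _ (by omega))]
      simp

/-- `V ⊗_R S` with `(u ⊗ s)_n (v ⊗ t) = ∑_j u_{n+j} v ⊗ D_j(s) t` and vacuum `1 ⊗ 1`. -/
noncomputable instance : VertexRing (BaseChange R V S) where
  nprod n x y := prodHom n x y
  vac := tmul R vac vac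
  nprod_add n u v w := map_add _ _ _
  add_nprod n u v w := by rw [map_add, AddMonoidHom.add_apply]
  regularity := prodHom_regular
  creation v := ⟨(creation_aux _ v).1 rfl, fun n hn => (creation_aux n v).2 hn⟩
  jacobi x y z l m n := by
    obtain ⟨N₀, h₀⟩ := jacobi_truncated x y z l m n
    obtain ⟨N₁, h₁⟩ := prodHom_regular x y
    obtain ⟨N₂, h₂⟩ := prodHom_regular y z
    obtain ⟨N₃, h₃⟩ := prodHom_regular x z
    have h := h₀ (N₀ + (N₁ - l).toNat + (N₂ - n).toNat + (N₃ - m).toNat) (by omega)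
    rwa [← finsum_eq_range (fun i hi => by
        rw [h₁ _ (by omega), map_zero, AddMonoidHom.zero_apply, smul_zero]),
      ← finsum_eq_range (fun i hi => by
        rw [h₂ _ (by omega), h₃ _ (by omega), map_zero, map_zero, smul_zero, sub_zero,
          smul_zero])] at h

theorem vac_def : (vac : BaseChange R V S) = tmul R vac vac := rfl

theorem tmul_nprod_tmul (n : ℤ) (u : V) (s : S) (v : V) (t : S) :
    nprod n (tmul R u s) (tmul R v t) =
      ∑ᶠ j : ℕ, tmul R (nprod (n + j) u v) (D j s * t) := rfl

/-- `V ⊗_R S` is an `S`-vertex algebra via `s ↦ 1 ⊗ s`. -/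
noncomputable instance : VertexAlgebra S (BaseChange R V S) where
  ι :=
    { toFun := fun s => tmul R vac s
      map_zero' := tmul_zero _
      map_add' := tmul_add _
      map_nprod' := fun n s t => by
        rw [tmul_nprod_tmul]
        rcases le_or_gt 0 n with h | h
        · rw [nprod_nonneg _ _ h, finsum_eq_range (N := 0) (fun j _ => by
            rw [nprod_vac_of_nonneg _ (by omega), zero_tmul])]
          simp
        · obtain ⟨k, rfl⟩ : ∃ k : ℕ, n = -(k : ℤ) - 1 := ⟨(-n - 1).toNat, by omega⟩
          rw [finsum_eq_single _ k, D_mul_eq, show -(k : ℤ) - 1 + k = -1 by ring,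
            nprod_neg_one_vac]
          intro j hj
          rw [vac_nprod, if_neg (by omega), zero_tmul]
      map_vac' := rfl }
  ι_mem_centre s x n hn := by
    change nprod n (tmul R vac s) x = 0 ∧ nprod n x (tmul R vac s) = 0
    induction x using induction_on with
    | zero => simp
    | add x y hx hy => rw [nprod_add, add_nprod, hx.1, hx.2, hy.1, hy.2, add_zero]; simp
    | tmul v t =>
      rw [tmul_nprod_tmul, tmul_nprod_tmul, finsum_eq_range (N := 0) (fun j _ => by
          rw [vac_nprod, if_neg (by omega), zero_tmul]),
        finsum_eq_range (N := 0) (fun j _ => by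
          rw [nprod_vac_of_nonneg _ (by omega), zero_tmul])]
      simp

theorem smul_tmul' (a : S) (v : V) (s : S) : a • tmul R v s = tmul R v (a * s) := by
  change nprod (-1) (tmul R vac a) (tmul R v s) = _
  rw [tmul_nprod_tmul, finsum_eq_single _ 0]
  · simp [D_zero]
  · intro j hj
    rw [vac_nprod, if_neg (by omega), zero_tmul]

theorem tmul_eq_smul (v : V) (s : S) : tmul R v s = s • tmul R v (1 : S) := by
  rw [smul_tmul', mul_one]

end
end BaseChange

/-! ## Homomorphisms of `R`-vertex algebras, generators and the category of commutative ones -/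

section Hom

open VertexRing VertexAlgebra

/-- Homomorphisms of `R`-vertex algebras: vertex ring homomorphisms compatible with the structure
maps. -/
structure VertexAlgHom (R V W : Type u) [CommVertexRing R] [VertexRing V] [VertexAlgebra R V]
    [VertexRing W] [VertexAlgebra R W] extends VertexRingHom V W where
  map_str' : ∀ r : R, toFun (str R V r) = str R W r

namespace VertexAlgHom

variable {R V W X : Type u} [CommVertexRing R] [VertexRing V] [VertexAlgebra R V]
  [VertexRing W] [VertexAlgebra R W] [VertexRing X] [VertexAlgebra R X]

instance : FunLike (VertexAlgHom R V W) V W where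
  coe f := f.toFun
  coe_injective f g h := by
    rcases f with ⟨⟨⟨⟨f, _⟩, _⟩, _, _⟩, _⟩
    rcases g with ⟨⟨⟨⟨g, _⟩, _⟩, _, _⟩, _⟩
    cases h
    rfl

@[ext] theorem ext {f g : VertexAlgHom R V W} (h : ∀ x, f x = g x) : f = g := DFunLike.ext _ _ h

instance : AddMonoidHomClass (VertexAlgHom R V W) V W where
  map_add f := f.map_add'
  map_zero f := f.map_zero'

theorem map_nprod (f : VertexAlgHom R V W) (n : ℤ) (x y : V) :
    f (nprod n x y) = nprod n (f x) (f y) := f.map_nprod' n x y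

theorem map_vac (f : VertexAlgHom R V W) : f vac = vac := f.map_vac'

theorem map_str (f : VertexAlgHom R V W) (r : R) : f (str R V r) = str R W r := f.map_str' r

theorem map_smul (f : VertexAlgHom R V W) (r : R) (x : V) : f (r • x) = r • f x := by
  rw [VertexAlgebra.smul_def, map_nprod, map_str, VertexAlgebra.smul_def]

theorem map_D (f : VertexAlgHom R V W) (a : ℕ) (x : V) : f (D a x) = D a (f x) := by
  rw [D, map_nprod, map_vac, D]

/-- The identity homomorphism. -/
def id (R V : Type u) [CommVertexRing R] [VertexRing V] [VertexAlgebra R V] :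
    VertexAlgHom R V V where
  toFun x := x
  map_zero' := rfl
  map_add' _ _ := rfl
  map_nprod' _ _ _ := rfl
  map_vac' := rfl
  map_str' _ := rfl

/-- Composition of homomorphisms. -/
def comp (g : VertexAlgHom R W X) (f : VertexAlgHom R V W) : VertexAlgHom R V X where
  toFun x := g (f x)
  map_zero' := by rw [map_zero, map_zero]
  map_add' x y := by rw [map_add, map_add]
  map_nprod' n x y := by rw [map_nprod, map_nprod]
  map_vac' := by rw [map_vac, map_vac]
  map_str' r := by rw [map_str, map_str]

@[simp] theorem id_apply (x : V) : id R V x = x := rfl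

@[simp] theorem comp_apply (g : VertexAlgHom R W X) (f : VertexAlgHom R V W) (x : V) :
    g.comp f x = g (f x) := rfl

end VertexAlgHom

/-- The subset `T` generates the `R`-vertex algebra `V`: the only `R`-vertex subalgebra of `V`
(subgroup closed under all products and containing the image of `R`) that contains `T` is `V`. -/
def VertexAlgebra.Generates (R : Type u) {V : Type u} [CommVertexRing R] [VertexRing V]
    [VertexAlgebra R V] (T : Set V) : Prop :=
  ∀ W : AddSubgroup V, (∀ r : R, str R V r ∈ W) →
    (∀ (n : ℤ) (x y : V), x ∈ W → y ∈ W → nprod n x y ∈ W) → T ⊆ W → W = ⊤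

/-- Finitely generated `R`-vertex algebras. -/
def VertexAlgebra.FinitelyGenerated (R V : Type u) [CommVertexRing R] [VertexRing V]
    [VertexAlgebra R V] : Prop :=
  ∃ T : Set V, T.Finite ∧ Generates R T

/-- Commutative `R`-vertex algebras. -/
structure CVA (R : Type u) [CommVertexRing R] : Type (u + 1) where
  carrier : Type u
  [commVertexRing : CommVertexRing carrier]
  [vertexAlgebra : VertexAlgebra R carrier]

attribute [instance] CVA.commVertexRing CVA.vertexAlgebra

/-- The category of commutative `R`-vertex algebras. -/
instance CVA.category (R : Type u) [CommVertexRing R] : CategoryTheory.Category.{u} (CVA R) where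
  Hom A B := VertexAlgHom R A.carrier B.carrier
  id A := VertexAlgHom.id R A.carrier
  comp f g := VertexAlgHom.comp g f

end Hom

/-! ## Filtrations and filtered automorphisms -/

section Filtration

open VertexRing VertexAlgebra

/-- A filtration on an `R`-vertex algebra. -/
structure VertexFiltration (R V : Type u) [CommVertexRing R] [VertexRing V]
    [VertexAlgebra R V] where
  piece : ℤ → Submodule R V
  le_succ : ∀ i : ℤ, piece i ≤ piece (i + 1)
  exhaustive : ∀ v : V, ∃ i : ℤ, v ∈ piece i
  vac_mem : vac ∈ piece 0
  nprod_mem : ∀ (m n l : ℤ) (u v : V), u ∈ piece m → v ∈ piece n →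
    nprod l u v ∈ piece (n + m - l - 1)

/-- The automorphism group of a filtered `R`-vertex algebra: bijective homomorphisms `f` of
`R`-vertex algebras such that both `f` and its inverse preserve the filtration. -/
def filteredAut {R V : Type u} [CommVertexRing R] [VertexRing V] [VertexAlgebra R V]
    (F : VertexFiltration R V) : Subgroup (Equiv.Perm V) where
  carrier := {f | (∀ x y : V, f (x + y) = f x + f y) ∧
    (∀ (n : ℤ) (x y : V), f (nprod n x y) = nprod n (f x) (f y)) ∧ f vac = vac ∧
    (∀ r : R, f (str R V r) = str R V r) ∧ ∀ (i : ℤ) (x : V), f x ∈ F.piece i ↔ x ∈ F.piece i}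
  mul_mem' := by
    rintro f g ⟨h0, h1, h2, h3, h4⟩ ⟨k0, k1, k2, k3, k4⟩
    refine ⟨fun x y => ?_, fun n x y => ?_, ?_, fun r => ?_, fun i x => ?_⟩
    · rw [Equiv.Perm.mul_apply, k0, h0]; rfl
    · rw [Equiv.Perm.mul_apply, k1, h1]; rfl
    · rw [Equiv.Perm.mul_apply, k2, h2]
    · rw [Equiv.Perm.mul_apply, k3, h3]
    · rw [Equiv.Perm.mul_apply, h4, k4]
  one_mem' := ⟨fun _ _ => rfl, fun _ _ _ => rfl, rfl, fun _ => rfl, fun _ _ => Iff.rfl⟩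
  inv_mem' := by
    rintro f ⟨h0, h1, h2, h3, h4⟩
    refine ⟨fun x y => ?_, fun n x y => ?_, ?_, fun r => ?_, fun i x => ?_⟩
    · apply f.injective; simp [h0]
    · apply f.injective; simp [h1]
    · apply f.injective; simp [h2]
    · apply f.injective; simp [h3]
    · rw [← h4]; simp

/-- A filtered automorphism as a homomorphism. -/
def autHom {R V : Type u} [CommVertexRing R] [VertexRing V] [VertexAlgebra R V]
    {F : VertexFiltration R V} (f : filteredAut F) : VertexAlgHom R V V where
  toFun x := f.1 x
  map_zero' := by simpa using f.2.1 0 0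
  map_add' := f.2.1
  map_nprod' := f.2.2.1
  map_vac' := f.2.2.2.1
  map_str' := f.2.2.2.2.1

theorem VertexFiltration.mono {R V : Type u} [CommVertexRing R] [VertexRing V]
    [VertexAlgebra R V] (F : VertexFiltration R V) : Monotone F.piece :=
  monotone_int_of_le_succ F.le_succ

end Filtration

namespace BaseChange

open VertexRing CommVertexRing VertexAlgebra

section

variable {R V : Type u} [CommVertexRing R] [VertexRing V] [VertexAlgebra R V]

/-- The image of `P ⊗_R S` in `V ⊗_R S`, for an `R`-submodule `P` of `V`. -/
noncomputable def image (P : Submodule R V) (S : Type u) [CommVertexRing S] [VertexAlgebra R S] :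
    Submodule S (BaseChange R V S) where
  carrier := Set.range (TensorProduct.map P.subtype (LinearMap.id : S →ₗ[R] S))
  zero_mem' := ⟨0, map_zero _⟩
  add_mem' := by
    rintro _ _ ⟨x, rfl⟩ ⟨y, rfl⟩
    exact ⟨x + y, map_add _ x y⟩
  smul_mem' := by
    rintro c _ ⟨x, rfl⟩
    induction x using TensorProduct.induction_on with
    | zero => exact ⟨0, by rw [map_zero]; exact (smul_zero (A := BaseChange R V S) c).symm⟩
    | tmul v s => exact ⟨v ⊗ₜ (c * s), (smul_tmul' c (v : V) s).symm⟩
    | add x y hx hy =>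
      obtain ⟨x', hx'⟩ := hx
      obtain ⟨y', hy'⟩ := hy
      refine ⟨x' + y', ?_⟩
      rw [map_add, map_add, hx', hy']
      exact (smul_add (A := BaseChange R V S) c _ _).symm

variable {S : Type u} [CommVertexRing S] [VertexAlgebra R S]

theorem tmul_mem_image {P : Submodule R V} {v : V} (hv : v ∈ P) (s : S) :
    tmul R v s ∈ image P S := ⟨(⟨v, hv⟩ : P) ⊗ₜ s, rfl⟩

theorem image_induction {P : Submodule R V} {Q : BaseChange R V S → Prop} (zero : Q 0)
    (tmul : ∀ v ∈ P, ∀ s, Q (tmul R v s)) (add : ∀ x y, Q x → Q y → Q (x + y))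
    {x : BaseChange R V S} (hx : x ∈ image P S) : Q x := by
  obtain ⟨x, rfl⟩ := hx
  induction x using TensorProduct.induction_on with
  | zero => rw [map_zero]; exact zero
  | tmul v s => exact tmul v v.2 s
  | add x y hx hy => rw [map_add]; exact add _ _ hx hy

theorem image_mono {P Q : Submodule R V} (h : P ≤ Q) : image P S ≤ image Q S := fun _ hx =>
  image_induction (zero_mem _) (fun _ hv s => tmul_mem_image (h hv) s)
    (fun _ _ => add_mem) hx

/-- The filtration of `V ⊗_R S` by the images of `F_i V ⊗_R S`. -/
noncomputable def filtration (F : VertexFiltration R V) (S : Type u) [CommVertexRing S]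
    [VertexAlgebra R S] : VertexFiltration S (BaseChange R V S) where
  piece i := image (F.piece i) S
  le_succ i := image_mono (F.le_succ i)
  exhaustive x := by
    induction x using induction_on with
    | zero => exact ⟨0, zero_mem _⟩
    | tmul v s =>
      obtain ⟨i, hi⟩ := F.exhaustive v
      exact ⟨i, tmul_mem_image hi s⟩
    | add x y hx hy =>
      obtain ⟨i, hi⟩ := hx
      obtain ⟨j, hj⟩ := hy
      exact ⟨max i j, add_mem (image_mono (F.mono (le_max_left i j)) hi)
        (image_mono (F.mono (le_max_right i j)) hj)⟩
  vac_mem := tmul_mem_image F.vac_mem _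
  nprod_mem m n l x y hx hy := by
    refine image_induction (Q := fun x => nprod l x y ∈ _) ?_ (fun u hu s => ?_)
      (fun x x' h h' => ?_) hx
    · rw [zero_nprod]; exact zero_mem _
    · refine image_induction (Q := fun y => nprod l (tmul R u s) y ∈ _) ?_ (fun v hv t => ?_)
        (fun x x' h h' => ?_) hy
      · rw [nprod_zero]; exact zero_mem _
      · rw [tmul_nprod_tmul]
        exact finsum_induction (· ∈ image (F.piece (n + m - l - 1)) S) (zero_mem _)
          (fun _ _ => add_mem) fun j => tmul_mem_image
            (F.mono (by omega) (F.nprod_mem m n (l + j) u v hu hv)) _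
      · rw [nprod_add]; exact add_mem h h'
    · rw [add_nprod]; exact add_mem h h'

variable {S' : Type u} [CommVertexRing S'] [VertexAlgebra R S']

/-- The map `id ⊗ φ : V ⊗_R S → V ⊗_R S'`. -/
noncomputable def map (V : Type u) [VertexRing V] [VertexAlgebra R V] (φ : VertexAlgHom R S S') :
    BaseChange R V S →+ BaseChange R V S' :=
  TensorProduct.liftAddHom (R := R) (M := V) (N := S) (P := BaseChange R V S')
    (AddMonoidHom.mk' (fun v => AddMonoidHom.mk' (fun s => tmul R v (φ s))
      fun s s' => by rw [map_add, tmul_add]) fun v v' => by ext s; exact add_tmul v v' (φ s))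
    (fun r v s => by
      change tmul R (r • v) (φ s) = tmul R v (φ (r • s))
      rw [smul_tmul, φ.map_smul]; rfl)

theorem map_tmul (φ : VertexAlgHom R S S') (v : V) (s : S) :
    map V φ (tmul R v s) = tmul R v (φ s) := rfl

theorem map_mul' (φ : VertexAlgHom R S S') (s t : S) : φ (s * t) = φ s * φ t :=
  φ.map_nprod (-1) s t

theorem map_one' (φ : VertexAlgHom R S S') : φ (1 : S) = 1 := φ.map_vac

theorem map_smul' (φ : VertexAlgHom R S S') (s : S) (x : BaseChange R V S) :
    map V φ (s • x) = φ s • map V φ x := by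
  induction x using induction_on with
  | zero => rw [smul_zero, map_zero, smul_zero]
  | tmul v t => rw [smul_tmul', map_tmul, map_tmul, smul_tmul', map_mul']
  | add x y hx hy => rw [smul_add, map_add, hx, hy, map_add, smul_add]

theorem map_nprod (φ : VertexAlgHom R S S') (n : ℤ) (x y : BaseChange R V S) :
    map V φ (nprod n x y) = nprod n (map V φ x) (map V φ y) := by
  induction x using induction_on with
  | zero => rw [zero_nprod, map_zero, zero_nprod]
  | add x x' hx hx' => rw [add_nprod, map_add, hx, hx', map_add, add_nprod]
  | tmul u s =>
    induction y using induction_on with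
    | zero => rw [nprod_zero, map_zero, nprod_zero]
    | add x x' hx hx' => rw [nprod_add, map_add, hx, hx', map_add, nprod_add]
    | tmul v t =>
      obtain ⟨N, h⟩ := reg' u v n
      have h := h N le_rfl
      rw [map_tmul, map_tmul, tmul_nprod_tmul, tmul_nprod_tmul]
      rw [finsum_eq_range (fun j hj => by rw [h j hj, zero_tmul]), map_sum,
        finsum_eq_range (fun j hj => by rw [h j hj, zero_tmul])]
      refine Finset.sum_congr rfl fun j _ => ?_
      rw [map_tmul, map_mul', φ.map_D]

theorem map_mem (φ : VertexAlgHom R S S') {P : Submodule R V} {x : BaseChange R V S}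
    (hx : x ∈ image P S) : map V φ x ∈ image P S' := by
  refine image_induction (Q := fun x => map V φ x ∈ image P S') ?_ (fun v hv s => ?_)
    (fun x y h h' => ?_) hx
  · rw [map_zero]; exact zero_mem _
  · exact tmul_mem_image hv _
  · rw [map_add]; exact add_mem h h'

theorem tmul_one_nprod (n : ℤ) (u v : V) :
    nprod n (tmul R u (1 : S)) (tmul R v (1 : S)) = tmul R (nprod n u v) (1 : S) := by
  rw [tmul_nprod_tmul, finsum_eq_single _ 0]
  · simp [D_zero]
  · intro j hj
    rw [one_def, D_vac, if_neg hj, zero_mul, tmul_zero]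

/-- The `S'`-linear extension along `φ : S → S'` of an endomorphism `f` of `V ⊗_R S`, i.e.
`v ⊗ s' ↦ s' • (id ⊗ φ)(f (v ⊗ 1))`. -/
noncomputable def extendAddHom (φ : VertexAlgHom R S S')
    (f : VertexAlgHom S (BaseChange R V S) (BaseChange R V S)) :
    BaseChange R V S' →+ BaseChange R V S' :=
  TensorProduct.liftAddHom (R := R) (M := V) (N := S') (P := BaseChange R V S')
    (AddMonoidHom.mk' (fun v => AddMonoidHom.mk' (fun s => s • map V φ (f (tmul R v 1)))
      fun s s' => add_smul s s' _)
      fun v v' => by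
        ext s
        change s • map V φ (f (tmul R (v + v') 1)) = s • _ + s • _
        rw [add_tmul, map_add, map_add, smul_add])
    (fun r v s => by
      change s • map V φ (f (tmul R (r • v) 1)) = (r • s) • map V φ (f (tmul R v 1))
      rw [smul_tmul, ← smul_tmul', f.map_smul, map_smul', φ.map_str, ← mul_smul, mul_comm]
      rfl)

theorem extendAddHom_tmul (φ : VertexAlgHom R S S')
    (f : VertexAlgHom S (BaseChange R V S) (BaseChange R V S)) (v : V) (s : S') :
    extendAddHom φ f (tmul R v s) = s • map V φ (f (tmul R v 1)) := rfl

theorem extendAddHom_nprod (φ : VertexAlgHom R S S')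
    (f : VertexAlgHom S (BaseChange R V S) (BaseChange R V S)) (n : ℤ)
    (x y : BaseChange R V S') :
    extendAddHom φ f (nprod n x y) = nprod n (extendAddHom φ f x) (extendAddHom φ f y) := by
  induction x using induction_on with
  | zero => rw [zero_nprod, map_zero, zero_nprod]
  | add x x' hx hx' => rw [add_nprod, map_add, hx, hx', map_add, add_nprod]
  | tmul u s =>
    induction y using induction_on with
    | zero => rw [nprod_zero, map_zero, nprod_zero]
    | add x x' hx hx' => rw [nprod_add, map_add, hx, hx', map_add, nprod_add]
    | tmul v t =>
      obtain ⟨N, h⟩ := reg' u v n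
      have h := h N le_rfl
      have e : ∀ j : ℕ, nprod (n + j) (map V φ (f (tmul R u 1))) (map V φ (f (tmul R v 1))) =
          map V φ (f (tmul R (nprod (n + j) u v) 1)) := fun j => by
        rw [← map_nprod, ← f.map_nprod, tmul_one_nprod]
      rw [extendAddHom_tmul, extendAddHom_tmul, nprod_smul, smul_nprod,
        finsum_eq_range (N := N) (fun j hj => by
          rw [e, h j hj, zero_tmul, map_zero, map_zero, smul_zero]),
        tmul_nprod_tmul, finsum_eq_range (fun j hj => by rw [h j hj, zero_tmul]), map_sum,
        Finset.smul_sum]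
      refine Finset.sum_congr rfl fun j _ => ?_
      rw [extendAddHom_tmul, e, ← mul_smul, mul_comm]

/-- The extension of an endomorphism of the `S`-vertex algebra `V ⊗_R S` along `φ : S → S'`. -/
noncomputable def extend (φ : VertexAlgHom R S S')
    (f : VertexAlgHom S (BaseChange R V S) (BaseChange R V S)) :
    VertexAlgHom S' (BaseChange R V S') (BaseChange R V S') :=
  have hs : ∀ s : S', extendAddHom φ f (tmul R vac s) = tmul R vac s := fun s => by
    rw [extendAddHom_tmul, one_def, ← vac_def, f.map_vac, vac_def, map_tmul, smul_tmul',
      ← one_def, map_one', mul_one]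
  { extendAddHom φ f with
    map_nprod' := extendAddHom_nprod φ f
    map_vac' := hs vac
    map_str' := hs }

theorem extend_tmul (φ : VertexAlgHom R S S')
    (f : VertexAlgHom S (BaseChange R V S) (BaseChange R V S)) (v : V) (s : S') :
    extend φ f (tmul R v s) = s • map V φ (f (tmul R v 1)) := rfl

theorem algHom_ext {f g : VertexAlgHom S (BaseChange R V S) (BaseChange R V S)}
    (h : ∀ v : V, f (tmul R v 1) = g (tmul R v 1)) : f = g := by
  ext x
  induction x using induction_on with
  | zero => rw [map_zero, map_zero]
  | tmul v s => rw [tmul_eq_smul, f.map_smul, g.map_smul, h]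
  | add x y hx hy => rw [map_add, map_add, hx, hy]

theorem extend_map (φ : VertexAlgHom R S S')
    (f : VertexAlgHom S (BaseChange R V S) (BaseChange R V S)) (x : BaseChange R V S) :
    extend φ f (map V φ x) = map V φ (f x) := by
  induction x using induction_on with
  | zero => rw [map_zero, map_zero, map_zero, map_zero]
  | tmul v s => rw [map_tmul, extend_tmul, ← map_smul', ← f.map_smul, ← tmul_eq_smul]
  | add x y hx hy => rw [map_add, map_add, hx, hy, map_add, map_add]

theorem extend_tmul_one (φ : VertexAlgHom R S S')
    (f : VertexAlgHom S (BaseChange R V S) (BaseChange R V S)) (v : V) :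
    extend φ f (tmul R v 1) = map V φ (f (tmul R v 1)) := by
  rw [extend_tmul, one_smul]

theorem extend_id (φ : VertexAlgHom R S S') :
    extend φ (VertexAlgHom.id S (BaseChange R V S)) = VertexAlgHom.id S' _ := by
  refine algHom_ext fun v => ?_
  rw [extend_tmul_one, VertexAlgHom.id_apply, map_tmul, map_one', VertexAlgHom.id_apply]

theorem extend_comp (φ : VertexAlgHom R S S')
    (f g : VertexAlgHom S (BaseChange R V S) (BaseChange R V S)) :
    extend φ (f.comp g) = (extend φ f).comp (extend φ g) := by
  refine algHom_ext fun v => ?_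
  rw [extend_tmul_one, VertexAlgHom.comp_apply, VertexAlgHom.comp_apply, extend_tmul_one,
    extend_map]

theorem extend_mem (F : VertexFiltration R V) (φ : VertexAlgHom R S S')
    (f : VertexAlgHom S (BaseChange R V S) (BaseChange R V S)) {i : ℤ}
    (hf : ∀ x ∈ (filtration F S).piece i, f x ∈ (filtration F S).piece i)
    {x : BaseChange R V S'} (hx : x ∈ (filtration F S').piece i) :
    extend φ f x ∈ (filtration F S').piece i := by
  refine image_induction (Q := fun x => extend φ f x ∈ (filtration F S').piece i) ?_
    (fun v hv s => ?_) (fun x y h h' => ?_) hx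
  · rw [map_zero]; exact zero_mem _
  · rw [extend_tmul]
    exact Submodule.smul_mem _ _ (map_mem φ (hf _ (tmul_mem_image hv _)))
  · rw [map_add]; exact add_mem h h'

theorem autHom_mul {F : VertexFiltration R V} (f g : filteredAut F) :
    (autHom (f * g)) = (autHom f).comp (autHom g) := rfl

theorem autHom_one {F : VertexFiltration R V} :
    (autHom (1 : filteredAut F)) = VertexAlgHom.id R V := rfl

theorem extend_inv_apply (F : VertexFiltration R V) (φ : VertexAlgHom R S S')
    (f g : filteredAut (filtration F S)) (h : f * g = 1) (x : BaseChange R V S') :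
    extend φ (autHom f) (extend φ (autHom g) x) = x := by
  rw [← VertexAlgHom.comp_apply, ← extend_comp, ← autHom_mul, h, autHom_one, extend_id,
    VertexAlgHom.id_apply]

/-- The group homomorphism `Aut(V ⊗_R S) → Aut(V ⊗_R S')` of extension of scalars. -/
noncomputable def autMap (F : VertexFiltration R V) (φ : VertexAlgHom R S S') :
    filteredAut (filtration F S) →* filteredAut (filtration F S') where
  toFun f :=
    ⟨{ toFun := extend φ (autHom f)
       invFun := extend φ (autHom f⁻¹)
       left_inv := extend_inv_apply F φ f⁻¹ f (inv_mul_cancel f)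
       right_inv := extend_inv_apply F φ f f⁻¹ (mul_inv_cancel f) },
      map_add (extend φ (autHom f)),
      (extend φ (autHom f)).map_nprod, (extend φ (autHom f)).map_vac, (extend φ (autHom f)).map_str,
      fun i x => ⟨fun h => by
          have := extend_mem F φ (autHom f⁻¹)
            (fun x hx => ((f⁻¹).2.2.2.2.2 i x).2 hx) (i := i) h
          rwa [Equiv.coe_fn_mk,
            extend_inv_apply F φ f⁻¹ f (inv_mul_cancel f)] at this,
        fun h => extend_mem F φ (autHom f) (fun x hx => (f.2.2.2.2.2 i x).2 hx) h⟩⟩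
  map_one' := by
    ext x
    change extend φ (autHom (1 : filteredAut (filtration F S))) x = x
    rw [autHom_one, extend_id, VertexAlgHom.id_apply]
  map_mul' f g := by
    ext x
    change extend φ (autHom (f * g)) x = extend φ (autHom f) (extend φ (autHom g) x)
    rw [autHom_mul, extend_comp, VertexAlgHom.comp_apply]

theorem autMap_apply (F : VertexFiltration R V) (φ : VertexAlgHom R S S')
    (f : filteredAut (filtration F S)) (x : BaseChange R V S') :
    (autMap F φ f).1 x = extend φ (autHom f) x := rfl

end

end BaseChange

open BaseChange VertexRing CommVertexRing in
/-- The group functor `S ↦ Aut(V)(S) = Aut(V ⊗_R S)` (automorphisms of filtered `S`-vertex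
algebras) on the category of commutative `R`-vertex algebras. -/
noncomputable def autFunctor {R V : Type u} [CommVertexRing R] [VertexRing V] [VertexAlgebra R V]
    (F : VertexFiltration R V) : CategoryTheory.Functor (CVA R) GrpCat.{u} where
  obj S := GrpCat.of (filteredAut (filtration F S.carrier))
  map φ := GrpCat.ofHom (autMap F φ)
  map_id S := by
    refine GrpCat.hom_ext (MonoidHom.ext fun f => ?_)
    refine Subtype.ext (Equiv.ext fun x => ?_)
    change extend (VertexAlgHom.id R S.carrier) (autHom f) x = (autHom f) x
    have : extend (VertexAlgHom.id R S.carrier) (autHom f) = (autHom f) := by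
      refine algHom_ext fun v => ?_
      rw [extend_tmul_one]
      generalize (autHom f) (tmul R v 1) = y
      induction y using induction_on with
      | zero => rw [map_zero]
      | tmul v s => rfl
      | add x y hx hy => rw [map_add, hx, hy]
    rw [this]
  map_comp {S S' S''} φ ψ := by
    refine GrpCat.hom_ext (MonoidHom.ext fun f => ?_)
    refine Subtype.ext (Equiv.ext fun x => ?_)
    change extend (VertexAlgHom.comp ψ φ) (autHom f) x = extend ψ (autHom (autMap F φ f)) x
    have : extend (VertexAlgHom.comp ψ φ) (autHom f) = extend ψ (autHom (autMap F φ f)) := by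
      refine algHom_ext fun v => ?_
      rw [extend_tmul_one, extend_tmul_one]
      change _ = BaseChange.map V ψ (extend φ (autHom f) (tmul R v 1))
      rw [extend_tmul_one]
      generalize (autHom f) (tmul R v 1) = y
      induction y using induction_on with
      | zero => rw [map_zero, map_zero, map_zero]
      | tmul v s => rfl
      | add x y hx hy => rw [map_add, hx, hy, map_add, map_add]
    rw [this]

/-! ## Admissible pairs -/

/-- Admissible pairs `(ν, b)` for a family indexed by `κ`: a finite word of pairs `(c, k)`,
standing for the composition `ν` of the operators `c_k : x ↦ c_k x`, and an element `b`. -/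
abbrev AdmissiblePair (κ : Type*) : Type _ := List (κ × ℤ) × κ

/-- The vector `ν(b)` of an admissible pair `(ν, b)`; the empty word acts as the identity. -/
def AdmissiblePair.eval {V : Type u} [VertexRing V] {κ : Type*} (B : κ → V)
    (e : AdmissiblePair κ) : V :=
  e.1.foldr (fun c x => VertexRing.nprod c.2 (B c.1) x) (B e.2)

/-! The admissible pairs occurring in the sets `E m` form one basis of `V`, and each `F_m V` is a
direct summand. Over any `S`, a filtered automorphism of `V ⊗_R S` preserves the image of `F_n V ⊗_R
S`, so it acts on the finite family `B` by a `d × d` matrix over `S`. It is determined by this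
matrix: the value on `ν(b)` is the expression `ν` in the images of the vectors of `B`. Hence
`Aut(V)(S)` is identified with a set of pairs of matrices, those of `f` and of `f⁻¹`; carrying both
makes the entries of the inverse available among the generators.

No list of equations is written down. The representing algebra `A` consists of formal vertex algebra
expressions in `2d²` variables, two of them being identified when they agree at the matrix pair of
every filtered automorphism over every `S`. These expressions form a type in the given universe, so
the quantification over all `S` causes no size problem. Axioms of commutative vertex algebras hold
in `A` because they hold in each model, `A` is generated by the variables, and evaluations at models
are jointly injective on `A`.

The point is that `A` is itself a model: its tautological matrices come from a filtered automorphism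
over `A`. They define `A`-linear maps through the basis of admissible pairs, and in each model these
maps specialise to the actual `f` and `f⁻¹` (`map_univLin`). Every identity required of them is then
true after specialisation, and since `V` is free, equality in `V ⊗_R A` is tested coordinatewise in
models (`univ_ext`). Preservation of the filtration is not an equation in general, but it becomes
one once `F_m V` is cut out by a projection (`mem_image_of_map_mem`).

Pushing the universal automorphism forward gives `Hom(A, S) → Aut(V)(S)`. It is injective because an
automorphism determines its matrices, hence the values on the generators. It is surjective because
any `f` over `S` gives a model, and evaluation there carries the universal automorphism to `f`. -/

namespace BaseChange

open VertexRing CommVertexRing VertexAlgebra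

/-! ### Base change of bases and of direct summands. -/

section Basis

variable {R V : Type u} [CommVertexRing R] [VertexRing V] [VertexAlgebra R V] {ι : Type*}

open scoped Classical in
/-- The basis of `V ⊗_R S` over `S` induced by a basis of `V` over `R`. -/
noncomputable def basis (b : Module.Basis ι R V) (S : Type u) [CommVertexRing S]
    [VertexAlgebra R S] : Module.Basis ι S (BaseChange R V S) :=
  .ofRepr
    { (TensorProduct.equivFinsuppOfBasisLeft b : V ⊗[R] S ≃ₗ[R] ι →₀ S).toAddEquiv with
      map_smul' := fun s x => by
        change TensorProduct.equivFinsuppOfBasisLeft b (s • x : BaseChange R V S) =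
          s • TensorProduct.equivFinsuppOfBasisLeft b x
        induction x using induction_on with
        | zero =>
          rw [smul_zero]
          exact (map_zero (TensorProduct.equivFinsuppOfBasisLeft (N := S) b)).trans
            ((congrArg (s • ·) (map_zero (TensorProduct.equivFinsuppOfBasisLeft (N := S) b))).trans
              (smul_zero s)).symm
        | add x y hx hy =>
          rw [smul_add]
          refine (map_add (TensorProduct.equivFinsuppOfBasisLeft (N := S) b) _ _).trans ?_
          rw [hx, hy, ← smul_add]
          exact congrArg (s • ·)
            (map_add (TensorProduct.equivFinsuppOfBasisLeft (N := S) b) x y).symm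
        | tmul v t =>
          rw [smul_tmul']
          ext i
          refine (TensorProduct.equivFinsuppOfBasisLeft_apply_tmul_apply b v (s * t) i).trans ?_
          rw [Finsupp.smul_apply]
          refine .trans ?_ (congrArg (s • ·)
            (TensorProduct.equivFinsuppOfBasisLeft_apply_tmul_apply b v t i).symm)
          -- `R` acts on `S` through multiplication by `str R S`, so `S`-linearity is an identity in
          -- the commutative ring `S`.
          exact mul_left_comm (str R S (b.repr v i)) s t }

variable {S S' : Type u} [CommVertexRing S] [VertexAlgebra R S] [CommVertexRing S']
  [VertexAlgebra R S']

open scoped Classical in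
theorem basis_repr_tmul (b : Module.Basis ι R V) (v : V) (s : S) (i : ι) :
    (basis b S).repr (tmul R v s) i = b.repr v i • s :=
  TensorProduct.equivFinsuppOfBasisLeft_apply_tmul_apply b v s i

theorem basis_apply (b : Module.Basis ι R V) (i : ι) : basis b S i = tmul R (b i) 1 := by
  classical
  rw [← Module.Basis.repr_symm_single_one, LinearEquiv.symm_apply_eq]
  ext j
  rw [basis_repr_tmul, Module.Basis.repr_self, Finsupp.single_apply, Finsupp.single_apply]
  split_ifs
  · exact (one_smul R (1 : S)).symm
  · exact (zero_smul R (1 : S)).symm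

/-- The basis vectors `b i ⊗ 1` correspond to each other under `id ⊗ φ`, so only the coordinates are
moved. This transports joint injectivity from `S` to `V ⊗_R S`. -/
theorem basis_repr_map (b : Module.Basis ι R V) (φ : VertexAlgHom R S S')
    (x : BaseChange R V S) (i : ι) :
    (basis b S').repr (map V φ x) i = φ ((basis b S).repr x i) := by
  induction x using induction_on with
  | zero => simp
  | tmul v s => rw [map_tmul, basis_repr_tmul, basis_repr_tmul, φ.map_smul]
  | add x y hx hy => simp [hx, hy]

/-- A module basis of `V` allows one to test vanishing in `V ⊗_R S` coordinatewise. -/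
theorem eq_of_map_eq (b : Module.Basis ι R V) {P : ∀ T : CVA R, VertexAlgHom R S T.carrier → Prop}
    (hP : ∀ s t : S, (∀ T φ, P T φ → φ s = φ t) → s = t) {x y : BaseChange R V S}
    (h : ∀ T φ, P T φ → map V φ x = map V φ y) : x = y := by
  refine (basis b S).repr.injective (Finsupp.ext fun i => hP _ _ fun T φ hφ => ?_)
  rw [← basis_repr_map, ← basis_repr_map, h T φ hφ]

/-- The map `q ⊗ id` on `V ⊗_R S`. -/
noncomputable def mapLeft (q : V →ₗ[R] V) (S : Type u) [CommVertexRing S] [VertexAlgebra R S] :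
    BaseChange R V S →+ BaseChange R V S :=
  (TensorProduct.map q (LinearMap.id : S →ₗ[R] S)).toAddMonoidHom

theorem mapLeft_tmul (q : V →ₗ[R] V) (v : V) (s : S) :
    mapLeft q S (tmul R v s) = tmul R (q v) s := rfl

theorem map_mapLeft (q : V →ₗ[R] V) (φ : VertexAlgHom R S S') (x : BaseChange R V S) :
    map V φ (mapLeft q S x) = mapLeft q S' (map V φ x) := by
  induction x using induction_on with
  | zero => simp only [map_zero]
  | tmul v s => rfl
  | add x y hx hy => simp only [map_add, hx, hy]

theorem mapLeft_mem {q : V →ₗ[R] V} {P : Submodule R V} (hq : ∀ v, q v ∈ P)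
    (x : BaseChange R V S) : mapLeft q S x ∈ image P S := by
  induction x using induction_on with
  | zero => rw [map_zero]; exact zero_mem _
  | tmul v s => exact tmul_mem_image (hq v) s
  | add x y hx hy => rw [map_add]; exact add_mem hx hy

theorem mapLeft_of_mem {q : V →ₗ[R] V} {P : Submodule R V} (hq : ∀ v ∈ P, q v = v)
    {x : BaseChange R V S} (hx : x ∈ image P S) : mapLeft q S x = x := by
  refine image_induction (Q := fun x => mapLeft q S x = x) (map_zero _) (fun v hv s => ?_)
    (fun x y hx hy => ?_) hx
  · rw [mapLeft_tmul, hq v hv]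
  · rw [map_add, hx, hy]

/-- Membership in the base change of a direct summand can be tested on a jointly injective
family. -/
theorem mem_image_of_map_mem (b : Module.Basis ι R V)
    {P : ∀ T : CVA R, VertexAlgHom R S T.carrier → Prop}
    (hP : ∀ s t : S, (∀ T φ, P T φ → φ s = φ t) → s = t) {M C : Submodule R V} (hC : IsCompl M C)
    {x : BaseChange R V S} (h : ∀ T φ, P T φ → map V φ x ∈ image M T.carrier) :
    x ∈ image M S := by
  -- Belonging to the image of a direct summand means being fixed by the projection, base changed to
  -- `S`. This is an equation, so a jointly injective family detects it.
  have : mapLeft (M.projection C hC) S x = x := eq_of_map_eq b hP fun T φ hφ => by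
    rw [map_mapLeft]
    exact mapLeft_of_mem (fun v hv => Submodule.projection_apply_of_mem_left hC hv) (h T φ hφ)
  rw [← this]
  exact mapLeft_mem (fun v => Submodule.projection_apply_mem hC v) x

end Basis

/-! ### Compatibility of admissible pairs with base change and homomorphisms. -/

section Eval

variable {R V S S' : Type u} [CommVertexRing R] [VertexRing V] [VertexAlgebra R V]
  [CommVertexRing S] [VertexAlgebra R S] [CommVertexRing S'] [VertexAlgebra R S'] {κ : Type*}

theorem tmul_eval_one (B : κ → V) (e : AdmissiblePair κ) :
    tmul R (e.eval B) (1 : S) = e.eval fun j => tmul R (B j) (1 : S) := by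
  obtain ⟨l, j⟩ := e
  induction l with
  | nil => rfl
  | cons c l ih =>
    refine (tmul_one_nprod _ _ _).symm.trans ?_
    exact congrArg (nprod c.2 _) ih

theorem map_eval (φ : VertexAlgHom R S S') (W : κ → BaseChange R V S) (e : AdmissiblePair κ) :
    map V φ (e.eval W) = e.eval fun j => map V φ (W j) := by
  obtain ⟨l, j⟩ := e
  induction l with
  | nil => rfl
  | cons c l ih =>
    refine (map_nprod _ _ _ _).trans ?_
    exact congrArg (nprod c.2 _) ih

end Eval

end BaseChange

theorem VertexAlgHom.map_eval {R V W : Type u} [CommVertexRing R] [VertexRing V]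
    [VertexAlgebra R V] [VertexRing W] [VertexAlgebra R W] {κ : Type*} (f : VertexAlgHom R V W)
    (B : κ → V) (e : AdmissiblePair κ) : f (e.eval B) = e.eval fun j => f (B j) := by
  obtain ⟨l, j⟩ := e
  induction l with
  | nil => rfl
  | cons c l ih =>
    refine (f.map_nprod _ _ _).trans ?_
    exact congrArg (VertexRing.nprod c.2 _) ih

/-! ## Commutative vertex algebras presented by generators and a class of models -/

/-- Formal expressions in the operations of an `R`-vertex algebra, with variables in `κ`. -/
inductive VertexTerm (R : Type u) (κ : Type) : Type u
  | gen : κ → VertexTerm R κ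
  | str : R → VertexTerm R κ
  | add : VertexTerm R κ → VertexTerm R κ → VertexTerm R κ
  | neg : VertexTerm R κ → VertexTerm R κ
  | nprod : ℤ → VertexTerm R κ → VertexTerm R κ → VertexTerm R κ

namespace VertexTerm

open VertexRing CommVertexRing VertexAlgebra

variable {R : Type u} [CommVertexRing R] {κ : Type}

/-- The value of a formal expression. -/
def eval {S : Type u} [CommVertexRing S] [VertexAlgebra R S] (x : κ → S) : VertexTerm R κ → S
  | gen k => x k
  | str r => VertexAlgebra.str R S r
  | add t t' => eval x t + eval x t'
  | neg t => -eval x t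
  | nprod n t t' => VertexRing.nprod n (eval x t) (eval x t')

/-- Two expressions are identified if they agree in all models of the class `G`. -/
def setoid (G : ∀ S : CVA R, (κ → S.carrier) → Prop) : Setoid (VertexTerm R κ) where
  r t t' := ∀ S x, G S x → eval x t = eval x t'
  iseqv := ⟨fun _ _ _ _ => rfl, fun h S x hx => (h S x hx).symm,
    fun h h' S x hx => (h S x hx).trans (h' S x hx)⟩

end VertexTerm

/-- The commutative `R`-vertex algebra generated by `κ`, subject to all relations that hold in the
class `G` of models. -/
def UniversalCVA {R : Type u} [CommVertexRing R] {κ : Type}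
    (G : ∀ S : CVA R, (κ → S.carrier) → Prop) : Type u := Quotient (VertexTerm.setoid G)

namespace UniversalCVA

open VertexRing CommVertexRing VertexAlgebra

variable {R : Type u} [CommVertexRing R] {κ : Type} {G : ∀ S : CVA R, (κ → S.carrier) → Prop}

variable (G) in
/-- The class of a formal expression. -/
def mk (t : VertexTerm R κ) : UniversalCVA G := Quotient.mk _ t

@[elab_as_elim]
theorem ind {P : UniversalCVA G → Prop} (mk : ∀ t, P (mk G t)) (a : UniversalCVA G) : P a :=
  Quotient.ind mk a

/-- Evaluation at a model. -/
def eval (S : CVA R) (x : κ → S.carrier) (hx : G S x) (a : UniversalCVA G) : S.carrier :=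
  Quotient.lift (VertexTerm.eval x) (fun t t' (h : VertexTerm.setoid G t t') => h S x hx) a

/-- Agreement in all models is the relation defining the quotient. Through this, each equational
axiom is inherited from the models. -/
theorem ext_eval {a b : UniversalCVA G} (h : ∀ S x hx, eval S x hx a = eval S x hx b) :
    a = b := by
  induction a using ind
  induction b using ind
  exact Quotient.sound h

instance : Zero (UniversalCVA G) := ⟨mk G (.str 0)⟩

instance : Add (UniversalCVA G) :=
  ⟨Quotient.map₂ .add fun _ _ h _ _ h' S x hx => congrArg₂ (· + ·) (h S x hx) (h' S x hx)⟩

instance : Neg (UniversalCVA G) :=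
  ⟨Quotient.map .neg fun t t' (h : VertexTerm.setoid G t t') S x hx =>
    congrArg (- ·) (h S x hx)⟩

/-- The `n`-th product. -/
def prod (n : ℤ) : UniversalCVA G → UniversalCVA G → UniversalCVA G :=
  Quotient.map₂ (.nprod n) fun _ _ h _ _ h' S x hx =>
    congrArg₂ (VertexRing.nprod n) (h S x hx) (h' S x hx)

theorem eval_zero (S : CVA R) (x : κ → S.carrier) (hx : G S x) : eval S x hx 0 = 0 := str_zero

theorem eval_add (S : CVA R) (x : κ → S.carrier) (hx : G S x) (a b : UniversalCVA G) :
    eval S x hx (a + b) = eval S x hx a + eval S x hx b := by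
  induction a using ind
  induction b using ind
  rfl

theorem eval_neg (S : CVA R) (x : κ → S.carrier) (hx : G S x) (a : UniversalCVA G) :
    eval S x hx (-a) = -eval S x hx a := by
  induction a using ind
  rfl

theorem eval_prod (S : CVA R) (x : κ → S.carrier) (hx : G S x) (n : ℤ) (a b : UniversalCVA G) :
    eval S x hx (prod n a b) = nprod n (eval S x hx a) (eval S x hx b) := by
  induction a using ind
  induction b using ind
  rfl

instance : AddCommGroup (UniversalCVA G) where
  add_assoc a b c := ext_eval fun S x hx => by simp only [eval_add, add_assoc]
  zero_add a := ext_eval fun S x hx => by simp only [eval_add, eval_zero, zero_add]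
  add_zero a := ext_eval fun S x hx => by simp only [eval_add, eval_zero, add_zero]
  nsmul := nsmulRec
  zsmul := zsmulRec
  neg_add_cancel a := ext_eval fun S x hx => by
    simp only [eval_add, eval_neg, eval_zero, neg_add_cancel]
  add_comm a b := ext_eval fun S x hx => by simp only [eval_add, add_comm]

/-- Evaluation at a model, as an additive map. -/
def evalAddHom (S : CVA R) (x : κ → S.carrier) (hx : G S x) : UniversalCVA G →+ S.carrier :=
  AddMonoidHom.mk' (eval S x hx) (eval_add S x hx)

theorem ext_evalAddHom {a b : UniversalCVA G}
    (h : ∀ S x hx, evalAddHom S x hx a = evalAddHom S x hx b) : a = b := ext_eval h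

theorem evalAddHom_prod (S : CVA R) (x : κ → S.carrier) (hx : G S x) (n : ℤ)
    (a b : UniversalCVA G) :
    evalAddHom S x hx (prod n a b) = nprod n (evalAddHom S x hx a) (evalAddHom S x hx b) :=
  eval_prod S x hx n a b

theorem prod_of_nonneg {n : ℤ} (hn : 0 ≤ n) (a b : UniversalCVA G) : prod n a b = 0 :=
  ext_evalAddHom fun S x hx => by rw [evalAddHom_prod, nprod_nonneg _ _ hn, map_zero]

theorem prod_zero (n : ℤ) (a : UniversalCVA G) : prod n a 0 = 0 :=
  ext_evalAddHom fun S x hx => by rw [evalAddHom_prod, map_zero, nprod_zero]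

theorem zero_prod (n : ℤ) (a : UniversalCVA G) : prod n 0 a = 0 :=
  ext_evalAddHom fun S x hx => by rw [evalAddHom_prod, map_zero, zero_nprod]

/-- Evaluation commutes with finite sums only, so the sums are truncated at a bound that serves the
quotient and every model at once. -/
theorem prod_jacobi (u v w : UniversalCVA G) (l m n : ℤ) :
    ∑ᶠ i : ℕ, Ring.choose m i • prod (m + n - i) (prod (l + i) u v) w =
    ∑ᶠ i : ℕ, ((-1 : ℤ) ^ i * Ring.choose l i) •
      (prod (m + l - i) u (prod (n + i) v w)
        - (Int.negOnePow l : ℤ) • prod (n + l - i) v (prod (m + i) u w)) := by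
  -- From this index on, `l + i`, `m + i` and `n + i` are nonnegative, and nonnegative products
  -- vanish in a commutative vertex ring.
  set N := l.natAbs + m.natAbs + n.natAbs
  rw [finsum_eq_range (N := N) (fun i hi => by
      rw [prod_of_nonneg (n := l + i) (by omega), zero_prod, smul_zero]),
    finsum_eq_range (N := N) (fun i hi => by
      rw [prod_of_nonneg (n := n + i) (by omega), prod_of_nonneg (n := m + i) (by omega),
        prod_zero, prod_zero, smul_zero, sub_zero, smul_zero])]
  refine ext_evalAddHom fun S x hx => ?_
  simp only [map_sum, map_zsmul, map_sub, evalAddHom_prod]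
  have := jacobi (evalAddHom S x hx u) (evalAddHom S x hx v) (evalAddHom S x hx w) l m n
  rwa [finsum_eq_range (N := N) (fun i hi => by
      rw [nprod_nonneg (n := l + i) _ _ (by omega), zero_nprod, smul_zero]),
    finsum_eq_range (N := N) (fun i hi => by
      rw [nprod_nonneg (n := n + i) _ _ (by omega), nprod_nonneg (n := m + i) _ _ (by omega),
        nprod_zero, nprod_zero, smul_zero, sub_zero, smul_zero])] at this

instance : CommVertexRing (UniversalCVA G) where
  nprod := prod
  vac := mk G (.str vac)
  nprod_add n u v w := ext_evalAddHom fun S x hx => by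
    simp only [evalAddHom_prod, map_add, nprod_add]
  add_nprod n u v w := ext_evalAddHom fun S x hx => by
    simp only [evalAddHom_prod, map_add, add_nprod]
  regularity u v := ⟨0, fun n hn => prod_of_nonneg hn u v⟩
  creation v := ⟨ext_evalAddHom fun S x hx => by
      rw [evalAddHom_prod, show evalAddHom S x hx (mk G (.str vac)) = vac from str_vac,
        nprod_neg_one_vac],
    fun n hn => prod_of_nonneg hn v _⟩
  jacobi := prod_jacobi
  mem_centre r u n hn := ⟨prod_of_nonneg hn r u, prod_of_nonneg hn u r⟩

instance : VertexAlgebra R (UniversalCVA G) where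
  ι :=
    { toFun := fun r => mk G (.str r)
      map_zero' := rfl
      map_add' := fun r s => ext_evalAddHom fun S x hx => by
        rw [map_add]; exact str_add r s
      map_nprod' := fun n r s => ext_evalAddHom fun S x hx =>
        (str_nprod n r s).trans (evalAddHom_prod S x hx n (mk G (.str r)) (mk G (.str s))).symm
      map_vac' := rfl }
  ι_mem_centre r := mem_centre _

/-- The generators. -/
def gen (k : κ) : UniversalCVA G := mk G (.gen k)

variable (G) in
/-- The universal algebra as an object of the category of commutative `R`-vertex algebras. -/
def obj : CVA R := ⟨UniversalCVA G⟩

/-- Evaluation at a model, as a homomorphism. -/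
def evalHom (S : CVA R) (x : κ → S.carrier) (hx : G S x) :
    VertexAlgHom R (UniversalCVA G) S.carrier where
  toFun := eval S x hx
  map_zero' := eval_zero S x hx
  map_add' := eval_add S x hx
  map_nprod' := eval_prod S x hx
  map_vac' := str_vac
  map_str' _ := rfl

@[elab_as_elim]
theorem induction {P : UniversalCVA G → Prop} (a : UniversalCVA G) (gen : ∀ k, P (gen k))
    (str : ∀ r, P (str R _ r)) (add : ∀ a b, P a → P b → P (a + b)) (neg : ∀ a, P a → P (-a))
    (nprod : ∀ n a b, P a → P b → P (nprod n a b)) : P a := by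
  induction a using ind with
  | mk t =>
    induction t with
    | gen k => exact gen k
    | str r => exact str r
    | add t t' h h' => exact add _ _ h h'
    | neg t h => exact neg _ h
    | nprod n t t' h h' => exact nprod n _ _ h h'

theorem hom_ext {V : Type u} [VertexRing V] [VertexAlgebra R V]
    {φ ψ : VertexAlgHom R (UniversalCVA G) V} (h : ∀ k, φ (gen k) = ψ (gen k)) : φ = ψ := by
  ext a
  induction a using induction with
  | gen k => exact h k
  | str r => rw [φ.map_str, ψ.map_str]
  | add a b ha hb => rw [map_add, map_add, ha, hb]
  | neg a ha => rw [map_neg, map_neg, ha]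
  | nprod n a b ha hb => rw [φ.map_nprod, ψ.map_nprod, ha, hb]

theorem finitelyGenerated [Finite κ] : FinitelyGenerated R (UniversalCVA G) := by
  refine ⟨Set.range gen, Set.finite_range _, fun W hstr hprod hgen => ?_⟩
  refine top_unique fun a _ => ?_
  induction a using induction with
  | gen k => exact hgen ⟨k, rfl⟩
  | str r => exact hstr r
  | add a b ha hb => exact W.add_mem (ha trivial) (hb trivial)
  | neg a ha => exact W.neg_mem (ha trivial)
  | nprod n a b ha hb => exact hprod n a b (ha trivial) (hb trivial)

/-- The models in `G` separate the elements of the universal algebra. -/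
theorem eq_of_evalHom_eq (a b : UniversalCVA G)
    (h : ∀ (T : CVA R) (φ : VertexAlgHom R (UniversalCVA G) T.carrier),
      G T (fun k => φ (gen k)) → φ a = φ b) : a = b :=
  ext_eval fun S x hx => h S (evalHom S x hx) hx

end UniversalCVA

/-! ## The universal filtered automorphism -/

namespace FilteredAut

open VertexRing CommVertexRing VertexAlgebra BaseChange

variable {R V : Type u} [CommVertexRing R] [VertexRing V] [VertexAlgebra R V] {d : ℕ}

/-- Index set for the entries of two `d × d` matrices. -/
abbrev Entry (d : ℕ) : Type := Bool × Fin d × Fin d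

/-- The image of the `j`-th vector of the family `B` under the matrix `x c`. -/
noncomputable def column {S : Type u} [CommVertexRing S] [VertexAlgebra R S] (B : Fin d → V)
    (x : Entry d → S) (c : Bool) (j : Fin d) : BaseChange R V S :=
  ∑ i, tmul R (B i) (x (c, i, j))

theorem map_column {S S' : Type u} [CommVertexRing S] [VertexAlgebra R S] [CommVertexRing S']
    [VertexAlgebra R S'] (B : Fin d → V) (φ : VertexAlgHom R S S') (x : Entry d → S) (c : Bool)
    (j : Fin d) : map V φ (column B x c j) = column B (fun k => φ (x k)) c j := by
  simp only [column, map_sum, map_tmul]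

/-- The filtered automorphism `f` acts on the family `B` by the matrix `x true`, and its inverse
by `x false`. -/
def HasMatrix (F : VertexFiltration R V) (B : Fin d → V) {S : Type u} [CommVertexRing S]
    [VertexAlgebra R S] (f : filteredAut (filtration F S)) (x : Entry d → S) : Prop :=
  (∀ j, autHom f (tmul R (B j) 1) = column B x true j) ∧
    ∀ j, autHom f⁻¹ (tmul R (B j) 1) = column B x false j

/-- Extension of scalars acts on matrices entrywise. For the inverse this uses that `autMap` is a
group homomorphism. -/
theorem HasMatrix.map {F : VertexFiltration R V} {B : Fin d → V} {S S' : Type u}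
    [CommVertexRing S] [VertexAlgebra R S] [CommVertexRing S'] [VertexAlgebra R S']
    {f : filteredAut (filtration F S)} {x : Entry d → S} (h : HasMatrix F B f x)
    (φ : VertexAlgHom R S S') : HasMatrix F B (autMap F φ f) fun k => φ (x k) := by
  refine ⟨fun j => ?_, fun j => ?_⟩
  · rw [← map_column, ← h.1]
    exact extend_tmul_one φ (autHom f) (B j)
  · rw [← map_column, ← h.2, ← map_inv]
    exact extend_tmul_one φ (autHom f⁻¹) (B j)

/-- The class of all matrices of filtered automorphisms. -/
def IsMatrix (F : VertexFiltration R V) (B : Fin d → V) (S : CVA R) (x : Entry d → S.carrier) :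
    Prop := ∃ f : filteredAut (filtration F S.carrier), HasMatrix F B f x

/-! ### Matrices and filtered automorphisms determine each other. -/

section

variable {F : VertexFiltration R V} {B : Fin d → V} {I : Set (AdmissiblePair (Fin d))}
  {e : Module.Basis I R V} {S : Type u} [CommVertexRing S] [VertexAlgebra R S]

/-- A homomorphism is determined by its values on a family whose admissible pairs span. -/
theorem hom_ext (he : ∀ i, e i = i.1.eval B) {W : Type u} [VertexRing W] [VertexAlgebra S W]
    {f g : VertexAlgHom S (BaseChange R V S) W}
    (h : ∀ j, f (tmul R (B j) 1) = g (tmul R (B j) 1)) : f = g := by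
  ext x
  induction (basis e S).mem_span x using Submodule.span_induction with
  | mem x hx =>
    obtain ⟨i, rfl⟩ := hx
    rw [basis_apply, he, tmul_eval_one, f.map_eval, g.map_eval]
    exact congrArg (AdmissiblePair.eval · i.1) (funext h)
  | zero => rw [map_zero, map_zero]
  | add x y _ _ hx hy => rw [map_add, map_add, hx, hy]
  | smul s x _ hx => rw [f.map_smul, g.map_smul, hx]

theorem HasMatrix.unique_aut (he : ∀ i, e i = i.1.eval B) {f g : filteredAut (filtration F S)}
    {x : Entry d → S} (hf : HasMatrix F B f x) (hg : HasMatrix F B g x) : f = g := by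
  have : autHom f = autHom g := hom_ext he fun j => (hf.1 j).trans (hg.1 j).symm
  exact Subtype.ext (Equiv.ext fun y => DFunLike.congr_fun this y)

/-- The pairs with empty word place the vectors of `B` among the basis vectors, so the matrix
entries are coordinates. -/
theorem column_injective (he : ∀ i, e i = i.1.eval B) (hI : ∀ j, ([], j) ∈ I) {x y : Entry d → S}
    (h : ∀ c j, column (R := R) B x c j = column B y c j) : x = y := by
  classical
  have hrepr : ∀ (x : Entry d → S) c i j,
      (basis e S).repr (column B x c j) ⟨([], i), hI i⟩ = x (c, i, j) := by
    intro x c i j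
    have hB : ∀ k, B k = e ⟨([], k), hI k⟩ := fun k => (he ⟨([], k), hI k⟩).symm
    rw [column, map_sum, Finsupp.finsetSum_apply, Finset.sum_eq_single i]
    · rw [basis_repr_tmul, hB, Module.Basis.repr_self, Finsupp.single_eq_same]
      exact one_smul R _
    · intro k _ hk
      rw [basis_repr_tmul, hB, Module.Basis.repr_self, Finsupp.single_eq_of_ne]
      · exact zero_smul R _
      · simpa using hk.symm
    · simp
  funext ⟨c, i, j⟩
  rw [← hrepr x, h, hrepr y]

theorem HasMatrix.unique_matrix (he : ∀ i, e i = i.1.eval B) (hI : ∀ j, ([], j) ∈ I)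
    {f : filteredAut (filtration F S)} {x y : Entry d → S} (hx : HasMatrix F B f x)
    (hy : HasMatrix F B f y) : x = y :=
  column_injective (R := R) he hI fun c j => by
    cases c
    · rw [← hx.2, hy.2]
    · rw [← hx.1, hy.1]

/-- Elements of `P` are `R`-combinations of the basis, and these coefficients move across the tensor
sign into `S`. -/
theorem exists_column {P : Submodule R V} (B : Module.Basis (Fin d) R P) {x : BaseChange R V S}
    (hx : x ∈ image P S) : ∃ s : Fin d → S, x = ∑ i, tmul R (B i : V) (s i) := by
  refine image_induction (Q := fun x => ∃ s : Fin d → S, x = ∑ i, tmul R (B i : V) (s i))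
    ⟨0, by simp⟩ (fun v hv s => ?_) ?_ hx
  · refine ⟨fun i => str R S (B.repr ⟨v, hv⟩ i) * s, ?_⟩
    have : v = ∑ i, B.repr ⟨v, hv⟩ i • (B i : V) := by
      refine (congrArg P.subtype (B.sum_repr ⟨v, hv⟩).symm).trans ?_
      simp only [map_sum, _root_.map_smul, Submodule.subtype_apply]
    conv_lhs => rw [this, sum_tmul]
    exact Finset.sum_congr rfl fun i _ => smul_tmul _ _ _
  · rintro _ _ ⟨s, rfl⟩ ⟨t, rfl⟩
    exact ⟨s + t, by simp only [Pi.add_apply, tmul_add, Finset.sum_add_distrib]⟩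

/-- Both `f` and `f⁻¹` preserve the step `n`, so they send its basis vectors to combinations of
basis vectors. -/
theorem exists_hasMatrix {n : ℤ} (B : Module.Basis (Fin d) R (F.piece n))
    (f : filteredAut (filtration F S)) :
    ∃ x : Entry d → S, HasMatrix F (fun j => (B j : V)) f x := by
  have h : ∀ (g : filteredAut (filtration F S)) j, ∃ s : Fin d → S,
      autHom g (tmul R (B j : V) 1) = ∑ i, tmul R (B i : V) (s i) := fun g j =>
    exists_column B ((g.2.2.2.2.2 n _).2 (tmul_mem_image (B j).2 1))
  choose s hs using h
  -- An entry is indexed by (matrix, row, column), while `s g j i` takes the column first; hence the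
  -- swap.
  exact ⟨fun k => s (cond k.1 f f⁻¹) k.2.2 k.2.1, fun j => hs f j, fun j => hs f⁻¹ j⟩

/-- The linear endomorphism sending `ν(b)`, for `(ν, b) ∈ I`, to the corresponding expression in
the family `W`. -/
noncomputable def lin (e : Module.Basis I R V) (W : Fin d → BaseChange R V S) :
    BaseChange R V S →ₗ[S] BaseChange R V S :=
  (basis e S).constr S fun i => i.1.eval W

/-- `lin e W` need not respect products. If `W` becomes the image of `B` under a homomorphism `f`,
then both sides are `φ`-semilinear and send the basis vector `ν(b)` to the expression `ν` in the
vectors `f (b ⊗ 1)`. -/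
theorem map_lin (he : ∀ i, e i = i.1.eval B) (W : Fin d → BaseChange R V S) {T : Type u}
    [CommVertexRing T] [VertexAlgebra R T] (φ : VertexAlgHom R S T)
    {f : VertexAlgHom T (BaseChange R V T) (BaseChange R V T)}
    (hf : ∀ j, f (tmul R (B j) 1) = map V φ (W j)) (z : BaseChange R V S) :
    map V φ (lin e W z) = f (map V φ z) := by
  induction (basis e S).mem_span z using Submodule.span_induction with
  | mem x hx =>
    obtain ⟨i, rfl⟩ := hx
    rw [lin, Module.Basis.constr_basis, map_eval, basis_apply, map_tmul, map_one', he,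
      tmul_eval_one, f.map_eval]
    simp only [hf]
  | zero => simp only [map_zero]
  | add x y _ _ hx hy => simp only [map_add, hx, hy]
  | smul s x _ hx => rw [_root_.map_smul, map_smul', map_smul', f.map_smul, hx]

end

/-! ### The automorphism over the algebra of matrix entries, and representability. -/

section Universal

variable (F : VertexFiltration R V) (B : Fin d → V) {I : Set (AdmissiblePair (Fin d))}
  (e : Module.Basis I R V)

/-- The algebra generated by the matrix entries of filtered automorphisms. -/
abbrev Univ : Type u := UniversalCVA (IsMatrix F B)

/-- The linear endomorphism given by the universal matrix. -/
noncomputable def univLin (c : Bool) :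
    BaseChange R V (Univ F B) →ₗ[Univ F B] BaseChange R V (Univ F B) :=
  lin e (column B UniversalCVA.gen c)

variable {F B e}

/-- In a model the tautological matrices become those of an actual automorphism and its inverse, so
`map_lin` applies. All properties of `univAut` are read off from this specialisation. -/
theorem map_univLin (he : ∀ i, e i = i.1.eval B) {T : CVA R}
    {φ : VertexAlgHom R (Univ F B) T.carrier}
    {f : filteredAut (filtration F T.carrier)}
    (hf : HasMatrix F B f fun k => φ (UniversalCVA.gen k)) (c : Bool)
    (z : BaseChange R V (Univ F B)) :
    map V φ (univLin F B e c z) = autHom (cond c f f⁻¹) (map V φ z) := by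
  refine map_lin he _ φ (fun j => ?_) z
  rw [map_column]
  cases c
  · exact hf.2 j
  · exact hf.1 j

/-- Models separate the elements of the universal algebra by construction; freeness of `V` extends
this to the base change. -/
theorem univ_ext {x y : BaseChange R V (Univ F B)} (e : Module.Basis I R V)
    (h : ∀ (T : CVA R) (φ : VertexAlgHom R (Univ F B) T.carrier)
      (f : filteredAut (filtration F T.carrier)),
      HasMatrix F B f (fun k => φ (UniversalCVA.gen k)) → map V φ x = map V φ y) : x = y :=
  eq_of_map_eq e UniversalCVA.eq_of_evalHom_eq fun T φ ⟨f, hf⟩ => h T φ f hf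

theorem univLin_mem (he : ∀ i, e i = i.1.eval B) (hF : ∀ m, ∃ C, IsCompl (F.piece m) C)
    (c : Bool) (m : ℤ) {x : BaseChange R V (Univ F B)}
    (hx : x ∈ (filtration F (Univ F B)).piece m) :
    univLin F B e c x ∈ (filtration F (Univ F B)).piece m := by
  obtain ⟨C, hC⟩ := hF m
  refine mem_image_of_map_mem e UniversalCVA.eq_of_evalHom_eq hC fun T φ ⟨f, hf⟩ => ?_
  rw [map_univLin he hf]
  exact ((cond c f f⁻¹).2.2.2.2.2 m _).2 (map_mem φ hx)

/-- The two families of generators are mutually inverse in each model, since there they come from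
`f` and `f⁻¹`; no determinant has to be inverted. -/
theorem univLin_univLin (he : ∀ i, e i = i.1.eval B) (c : Bool)
    (x : BaseChange R V (Univ F B)) : univLin F B e c (univLin F B e (!c) x) = x :=
  univ_ext e fun T φ f hf => by
    rw [map_univLin he hf, map_univLin he hf]
    cases c
    · exact f.1.symm_apply_apply _
    · exact f.1.apply_symm_apply _

/-- The universal filtered automorphism. -/
noncomputable def univAut (he : ∀ i, e i = i.1.eval B) (hF : ∀ m, ∃ C, IsCompl (F.piece m) C) :
    filteredAut (filtration F (Univ F B)) :=
  ⟨{ toFun := univLin F B e true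
     invFun := univLin F B e false
     left_inv := univLin_univLin he false
     right_inv := univLin_univLin he true },
    map_add (univLin F B e true),
    fun n x y => univ_ext e fun T φ f hf => by
      change map V φ (univLin F B e true _) =
        map V φ (nprod n (univLin F B e true x) (univLin F B e true y))
      rw [map_univLin he hf, map_nprod, map_nprod, map_univLin he hf, map_univLin he hf,
        VertexAlgHom.map_nprod],
    univ_ext e fun T φ f hf => by
      change map V φ (univLin F B e true vac) = _
      rw [map_univLin he hf, show map V φ vac = vac from congrArg (tmul R vac) φ.map_vac,
        VertexAlgHom.map_vac],
    fun r => univ_ext e fun T φ f hf => by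
      change map V φ (univLin F B e true (tmul R vac r)) = map V φ (tmul R vac r)
      rw [map_univLin he hf, map_tmul]
      exact VertexAlgHom.map_str _ (φ r),
    -- If the image of `x` lies in a step, the inverse map, which preserves that step as well,
    -- brings `x` back into it.
    fun m x => ⟨fun h => by
        have := univLin_mem he hF false m h
        exact (univLin_univLin he false x) ▸ this,
      fun h => univLin_mem he hF true m h⟩⟩

/-- This shows that the universal algebra belongs to the class of models defining it. The pair with
empty word at `j` is a basis vector, and `lin` sends it to the `j`-th column. -/
theorem univAut_hasMatrix (he : ∀ i, e i = i.1.eval B) (hI : ∀ j, ([], j) ∈ I)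
    (hF : ∀ m, ∃ C, IsCompl (F.piece m) C) :
    HasMatrix F B (univAut he hF) UniversalCVA.gen := by
  have key : ∀ c j, univLin F B e c (tmul R (B j) 1) = column B UniversalCVA.gen c j := by
    intro c j
    have : tmul R (B j) (1 : Univ F B) = basis e (Univ F B) ⟨([], j), hI j⟩ := by
      rw [basis_apply, he]; rfl
    rw [this, univLin, lin, Module.Basis.constr_basis]
    rfl
  exact ⟨key true, key false⟩

open CategoryTheory in
/-- The automorphism functor is corepresented by the universal algebra of matrix entries. -/
theorem nonempty_corepresentableBy {n : ℤ} (B : Module.Basis (Fin d) R (F.piece n))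
    (he : ∀ i, e i = i.1.eval fun j => (B j : V)) (hI : ∀ j, ([], j) ∈ I)
    (hF : ∀ m, ∃ C, IsCompl (F.piece m) C) :
    Nonempty ((autFunctor F ⋙ forget GrpCat).CorepresentableBy
      (UniversalCVA.obj (IsMatrix F fun j => (B j : V)))) := by
  have hu := univAut_hasMatrix he hI hF
  have hbij : ∀ S : CVA R, Function.Bijective fun
      φ : VertexAlgHom R (Univ F fun j => (B j : V)) S.carrier =>
        autMap F φ (univAut he hF) := by
    refine fun S => ⟨fun φ ψ h => UniversalCVA.hom_ext fun k => ?_, fun f => ?_⟩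
    -- The pushforward along `φ` has the matrices `φ (gen k)`, so equal pushforwards force equal
    -- values on generators.
    · have hφ := hu.map φ
      rw [show autMap F φ (univAut he hF) = autMap F ψ (univAut he hF) from h] at hφ
      exact congrFun (hφ.unique_matrix he hI (hu.map ψ)) k
    -- `f` makes its own matrices a model. The pushforward under evaluation there has the same
    -- matrices, hence equals `f`.
    · obtain ⟨x, hx⟩ := exists_hasMatrix B f
      exact ⟨UniversalCVA.evalHom S x ⟨f, hx⟩,
        (hu.map (UniversalCVA.evalHom S x ⟨f, hx⟩)).unique_aut he hx⟩
  exact ⟨{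
    homEquiv := fun {S} => Equiv.ofBijective _ (hbij S)
    -- Naturality is functoriality of extension of scalars, applied to the universal automorphism.
    homEquiv_comp := fun {S S'} g φ => by
      exact congrArg (fun h => h.hom (univAut he hF))
        ((autFunctor F).map_comp (X := UniversalCVA.obj (IsMatrix F fun j => (B j : V))) φ g) }⟩

end Universal

/-- The admissible pairs of the filtration steps form a basis, and all steps are direct
summands. -/
theorem exists_basis (F : VertexFiltration R V) (n : ℤ)
    (B : Module.Basis (Fin d) R (F.piece n))
    (E : ℤ → Set (AdmissiblePair (Fin d)))
    (hEn : E n = Set.range fun b => ([], b))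
    (hE : ∀ m : ℤ, n < m →
      LinearIndependent R (fun e : E m => AdmissiblePair.eval (fun b => (B b : V)) e.1) ∧
      Submodule.span R (AdmissiblePair.eval (fun b => (B b : V)) '' E m) = F.piece m)
    (hEmono : ∀ m : ℤ, n ≤ m → E m ⊆ E (m + 1))
    (hsplit : ∀ m : ℤ, m < n → ∃ C : Submodule R V,
      Disjoint (F.piece m) C ∧ F.piece m ⊔ C = F.piece n) :
    ∃ (I : Set (AdmissiblePair (Fin d))) (e : Module.Basis I R V),
      (∀ i, e i = i.1.eval fun j => (B j : V)) ∧ (∀ j, ([], j) ∈ I) ∧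
      ∀ m, ∃ C, IsCompl (F.piece m) C := by
  set ev : AdmissiblePair (Fin d) → V := AdmissiblePair.eval fun b => (B b : V)
  -- The union starts at `n + 1` because `hE` covers only `m > n`; `E n` is contained in it by
  -- monotonicity.
  set I : Set (AdmissiblePair (Fin d)) := ⋃ k : ℕ, E (n + 1 + k)
  have hEI : ∀ m, n ≤ m → E m ⊆ I := by
    intro m hm
    refine (hEmono m hm).trans ?_
    obtain ⟨k, rfl⟩ : ∃ k : ℕ, m = n + k := ⟨(m - n).toNat, by omega⟩
    rw [add_right_comm]
    exact Set.subset_iUnion (fun k : ℕ => E (n + 1 + k)) k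
  have hmono : Monotone fun k : ℕ => E (n + 1 + k) := monotone_nat_of_le_succ fun k => by
    have := hEmono (n + 1 + k) (by omega)
    rw [add_assoc (n + 1)] at this
    exact_mod_cast this
  -- A linear relation involves finitely many pairs, so by directedness it already lies in a single
  -- `E m`.
  have hli : LinearIndepOn R ev I :=
    linearIndepOn_iUnion_of_directed hmono.directed_le fun k => (hE _ (by omega)).1
  have hspan : ∀ m, n ≤ m → Submodule.span R (ev '' E m) = F.piece m := by
    intro m hm
    rcases hm.eq_or_lt with rfl | hm
    · have : ev '' E n = (F.piece n).subtype '' Set.range B := by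
        rw [hEn, ← Set.range_comp, ← Set.range_comp]
        rfl
      rw [this, Submodule.span_image, B.span_eq, Submodule.map_subtype_top]
    · exact (hE m hm).2
  have htop : Submodule.span R (ev '' I) = ⊤ := by
    refine top_unique fun v _ => ?_
    obtain ⟨i, hi⟩ := F.exhaustive v
    -- Only steps from `n` on are known to be spanned by admissible pairs, so the index is raised to
    -- at least `n`.
    have := F.mono (le_max_left i n) hi
    rw [← hspan _ (le_max_right i n)] at this
    exact Submodule.span_mono (Set.image_mono (hEI _ (le_max_right i n))) this
  have hrange : Set.range (fun i : I => ev i) = ev '' I := by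
    rw [Set.image_eq_range]
  refine ⟨I, Module.Basis.mk (v := fun i : I => ev i) hli (by rw [hrange, htop]), fun i => ?_,
    fun j => hEI n le_rfl (hEn ▸ ⟨j, rfl⟩), ?_⟩
  · exact Module.Basis.mk_apply (v := fun i : I => ev i) hli _ i
  have hge : ∀ m, n ≤ m → ∃ C, IsCompl (F.piece m) C := by
    intro m hm
    -- `F_m V` is spanned by part of a basis, so the remaining basis vectors span a complement.
    refine ⟨Submodule.span R (ev '' (I \ E m)), ?_, ?_⟩
    · rw [← hspan m hm]
      have := LinearIndependent.disjoint_span_image hli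
        (s := {i : I | i.1 ∈ E m}) (t := {i : I | i.1 ∉ E m})
        (Set.disjoint_left.2 fun i hi hi' => hi' hi)
      refine this.mono (Submodule.span_mono ?_) (Submodule.span_mono ?_)
      · rintro _ ⟨i, hi, rfl⟩
        exact ⟨⟨i, hEI m hm hi⟩, hi, rfl⟩
      · rintro _ ⟨i, hi, rfl⟩
        exact ⟨⟨i, hi.1⟩, hi.2, rfl⟩
    · rw [codisjoint_iff, ← hspan m hm, ← Submodule.span_union, ← Set.image_union,
        Set.union_sdiff_cancel (hEI m hm), htop]
  intro m
  rcases le_or_gt n m with hm | hm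
  · exact hge m hm
  · obtain ⟨C, hC, hsup⟩ := hsplit m hm
    obtain ⟨C', hC'⟩ := hge n le_rfl
    rw [← hsup] at hC'
    -- Below `n`, a complement in `F_n V` is enlarged by a complement of `F_n V` in `V`.
    exact ⟨C ⊔ C', hC.isCompl_sup_right_of_isCompl_sup_left hC'⟩

end FilteredAut

open CategoryTheory in
theorem mainTheorem9 {R V : Type u} [CommVertexRing R] [VertexRing V] [VertexAlgebra R V]
    (F : VertexFiltration R V) (n : ℤ) (hn : 0 ≤ n)
    (hgen : VertexAlgebra.Generates R (F.piece n : Set V))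
    (d : ℕ) (B : Module.Basis (Fin d) R (F.piece n))
    (E : ℤ → Set (AdmissiblePair (Fin d)))
    (hEn : E n = Set.range fun b => ([], b))
    (hE : ∀ m : ℤ, n < m →
      LinearIndependent R (fun e : E m => AdmissiblePair.eval (fun b => (B b : V)) e.1) ∧
      Submodule.span R (AdmissiblePair.eval (fun b => (B b : V)) '' E m) = F.piece m)
    (hEmono : ∀ m : ℤ, n ≤ m → E m ⊆ E (m + 1))
    (hsplit : ∀ m : ℤ, m < n → ∃ C : Submodule R V,
      Disjoint (F.piece m) C ∧ F.piece m ⊔ C = F.piece n) :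
    ∃ A : CVA R, VertexAlgebra.FinitelyGenerated R A.carrier ∧
      Nonempty ((autFunctor F ⋙ forget GrpCat).CorepresentableBy A) := by
  obtain ⟨I, e, he, hI, hF⟩ := FilteredAut.exists_basis F n B E hEn hE hEmono hsplit
  -- Finite generation holds because the generators are indexed by the `2d²` entries of two
  -- matrices.
  exact ⟨_, UniversalCVA.finitelyGenerated, FilteredAut.nonempty_corepresentableBy B he hI hF⟩
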